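/- Let $\theta\in(0,\pi/2)$, let $$\mathsf{Gui}(\theta)=\Big\{(r,z)\in(0,\infty)\times\mathbb R:\ -\tfrac{\pi}{\sin\theta}<z,\ \max(0,z\tan\theta)<r<z\tan\theta+\tfrac{\pi}{\cos\theta}\Big\},$$ let $\mathsf{Lay}(\theta)=\mathsf{Gui}(\theta)\times\mathbb S^1$ with $\mathbb S^1=\mathbb R/2\pi\mathbb Z$ (cylindrical coordinates $(r,z,\phi)$), and let $L^2_{\mathsf{cyl}}(\mathsf{Lay}(\theta))=L^2(\mathsf{Lay}(\theta);r\,dr\,dz\,d\phi)$ be the space of complex-valued square-integrable functions. For a real-valued $\omega\in L^2(\mathbb S^1)$ let $\mathbf A_\omega=\frac{\omega(\phi)}{r}\mathbf e_\phi$, and let $$Q_{\omega,\theta,0}[u]=\|(i\nabla-\mathbf A_\omega)u\|^2=\int_{\mathsf{Lay}(\theta)}\Big(|\partial_ru|^2+|\partial_zu|^2+\frac{|i\partial_\phi u-\omega u|^2}{r^2}\Big)r\,dr\,dz\,d\phi,\qquad u\in C_0^\infty(\mathsf{Lay}(\theta)).$$ This form is closable in $L^2_{\mathsf{cyl}}(\mathsf{Lay}(\theta))$.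 Let $Q_{\omega,\theta}$ be its closure, and let $\mathsf H_{\omega,\theta}$ be the operator associated with $Q_{\omega,\theta}$: $u\in\mathrm{dom}\,\mathsf H_{\omega,\theta}$ and $\mathsf H_{\omega,\theta}u=f$ if and only if $u\in\mathrm{dom}\,Q_{\omega,\theta}$, $f\in L^2_{\mathsf{cyl}}(\mathsf{Lay}(\theta))$ and $Q_{\omega,\theta}(u,v)=\langle f,v\rangle$ for all $v\in\mathrm{dom}\,Q_{\omega,\theta}$ (this determines $f$ uniquely and defines a linear operator). Let $\omega\in L^2(\mathbb S^1)$ be real-valued and $k\in\mathbb Z$, and put $$\Phi_\omega=\frac1{2\pi}\int_0^{2\pi}\omega(\phi)\,d\phi,\qquad V(\phi)=(\Phi_\omega+k)\phi-\int_0^\phi\omega(\xi)\,d\xi\quad(0\le\phi<2\pi),\qquad \mathsf G_Vu=e^{iV}u,$$ so that $\mathsf G_V$ is a unitary operator in $L^2_{\mathsf{cyl}}(\mathsf{Lay}(\theta))$. Regard the number $\Phi_\omega+k$ as a constant function on $\mathbb S^1$. Then: (i) $\mathrm{dom}\,Q_{\omega,\theta}=\mathsf G_V\big(\mathrm{dom}\,Q_{\Phi_\omega+k,\theta}\big)$;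 (ii) $Q_{\omega,\theta}[\mathsf G_Vu]=Q_{\Phi_\omega+k,\theta}[u]$ for all $u\in\mathrm{dom}\,Q_{\Phi_\omega+k,\theta}$. In particular, $\mathsf H_{\omega,\theta}$ and $\mathsf H_{\Phi_\omega+k,\theta}$ are unitarily equivalent, namely $\mathsf H_{\omega,\theta}=\mathsf G_V\,\mathsf H_{\Phi_\omega+k,\theta}\,\mathsf G_V^{-1}$, domains included. Consequently there is a constant $c\in[0,1/2]$, of the form $c=|\Phi_\omega+m|$ with $m\in\mathbb Z$, such that $\mathsf H_{\omega,\theta}$ is unitarily equivalent to $\mathsf H_{c,\theta}$. -/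

import Mathlib

open MeasureTheory Filter Topology Set

noncomputable section

namespace ConicalLayer

instance fact_two_pi_pos : Fact (0 < 2 * Real.pi) := ⟨Real.two_pi_pos⟩

/-- The circle `S¹ = ℝ / 2πℤ`. Its `volume` is the measure `dφ` of total mass `2π`. -/
abbrev S1 : Type := AddCircle (2 * Real.pi)

/-- Cylindrical coordinates `(r, z, φ)`. -/
abbrev Cyl : Type := ℝ × ℝ × S1

/-- The meridian domain. -/
def Gui (θ : ℝ) : Set (ℝ × ℝ) :=
  {p | 0 < p.1 ∧ -(Real.pi / Real.sin θ) < p.2 ∧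
    max 0 (p.2 * Real.tan θ) < p.1 ∧ p.1 < p.2 * Real.tan θ + Real.pi / Real.cos θ}

/-- The conical layer `Gui(θ) × S¹` in cylindrical coordinates. -/
def Lay (θ : ℝ) : Set Cyl := {p | (p.1, p.2.1) ∈ Gui θ}

/-- The measure `r dr dz dφ` on the conical layer. -/
def cylMeasure (θ : ℝ) : Measure Cyl :=
  ((volume : Measure Cyl).withDensity fun p => ENNReal.ofReal p.1).restrict (Lay θ)

/-- The Hilbert space `L²_cyl(Lay(θ))`. -/
abbrev L2 (θ : ℝ) : Type := Lp ℂ 2 (cylMeasure θ)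

/-- `u ∈ C₀^∞(Lay(θ))`: smooth (in the coordinates `r, z, φ`) with compact support in `Lay(θ)`. -/
def IsTest (θ : ℝ) (u : Cyl → ℂ) : Prop :=
  ContDiff ℝ ((⊤ : ℕ∞) : WithTop ℕ∞) (fun p : ℝ × ℝ × ℝ => u (p.1, p.2.1, (p.2.2 : S1))) ∧
    HasCompactSupport u ∧ tsupport u ⊆ Lay θ

/-- `∂_r u`. -/
def dr (u : Cyl → ℂ) (p : Cyl) : ℂ := deriv (fun r : ℝ => u (r, p.2.1, p.2.2)) p.1

/-- `∂_z u`. -/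
def dz (u : Cyl → ℂ) (p : Cyl) : ℂ := deriv (fun z : ℝ => u (p.1, z, p.2.2)) p.2.1

/-- `∂_φ u`. -/
def dphi (u : Cyl → ℂ) (p : Cyl) : ℂ :=
  deriv (fun s : ℝ => u (p.1, p.2.1, p.2.2 + (s : S1))) 0

/-- The vector field `(i∇ - A_ω)u` with `A_ω = (ω(φ)/r) e_φ`, in its components along the
orthonormal moving frame `(e_r, e_φ, e_z)`. -/
def magGrad (ω : S1 → ℝ) (u : Cyl → ℂ) (p : Cyl) : EuclideanSpace ℂ (Fin 3) :=
  !₂[Complex.I * dr u p,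
     Complex.I * (dphi u p / (p.1 : ℂ)) - ((ω p.2.2 / p.1 : ℝ) : ℂ) * u p,
     Complex.I * dz u p]

/-- The sesquilinear form of `Q_{ω,θ,0}` (conjugate-linear in the first argument). -/
def sesq0 (ω : S1 → ℝ) (θ : ℝ) (u v : Cyl → ℂ) : ℂ :=
  ∫ p, inner ℂ (magGrad ω u p) (magGrad ω v p) ∂(cylMeasure θ)

/-- The quadratic form `Q_{ω,θ,0}[u] = ‖(i∇ - A_ω)u‖²`. -/
def form0 (ω : S1 → ℝ) (θ : ℝ) (u : Cyl → ℂ) : ℝ :=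
  ∫ p, ‖magGrad ω u p‖ ^ 2 ∂(cylMeasure θ)

/-- Form convergence of a sequence of test functions `w n` to `u ∈ L²_cyl`: `w n → u` in `L²_cyl`
and `Q_{ω,θ,0}[w n - w m] → 0` as `n, m → ∞`. -/
def FormConv (ω : S1 → ℝ) (θ : ℝ) (w : ℕ → Cyl → ℂ) (u : L2 θ) : Prop :=
  (∀ n, IsTest θ (w n)) ∧
    Tendsto (fun n => eLpNorm (fun p => w n p - u p) 2 (cylMeasure θ)) atTop (𝓝 0) ∧
    ∀ ε > 0, ∃ N : ℕ, ∀ n ≥ N, ∀ m ≥ N, form0 ω θ (fun p => w n p - w m p) < ε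

/-- Closability of the form `Q_{ω,θ,0}`. -/
def FormClosable (ω : S1 → ℝ) (θ : ℝ) : Prop :=
  ∀ w : ℕ → Cyl → ℂ, FormConv ω θ w 0 → Tendsto (fun n => form0 ω θ (w n)) atTop (𝓝 0)

/-- The domain of the closure `Q_{ω,θ}`. -/
def domQ (ω : S1 → ℝ) (θ : ℝ) : Set (L2 θ) := {u | ∃ w, FormConv ω θ w u}

/-- The sesquilinear form of the closure `Q_{ω,θ}`: for `u, v ∈ dom Q_{ω,θ}`, the common limit of
`Q_{ω,θ,0}(w n, w' n)` along all sequences `w`, `w'` form-converging to `u` and `v`.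
(That limit exists because the form is closable; it is unique because such sequences exist.) -/
def sesqQ (ω : S1 → ℝ) (θ : ℝ) (u v : L2 θ) : ℂ :=
  Classical.epsilon fun c : ℂ => ∀ w w' : ℕ → Cyl → ℂ, FormConv ω θ w u → FormConv ω θ w' v →
    Tendsto (fun n => sesq0 ω θ (w n) (w' n)) atTop (𝓝 c)

/-- The quadratic form `Q_{ω,θ}[u]` (meaningful for `u ∈ domQ ω θ`). -/
def formQ (ω : S1 → ℝ) (θ : ℝ) (u : L2 θ) : ℝ := (sesqQ ω θ u u).re

/-- The graph of the operator associated with the closed form `Q_{ω,θ}`: the pairs `(u, f)` with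
`u ∈ dom Q_{ω,θ}` and `Q_{ω,θ}(u, v) = ⟨f, v⟩` for all `v ∈ dom Q_{ω,θ}`. -/
def assocGraph (ω : S1 → ℝ) (θ : ℝ) : Set (L2 θ × L2 θ) :=
  {x | x.1 ∈ domQ ω θ ∧ ∀ v ∈ domQ ω θ, sesqQ ω θ x.1 v = inner ℂ x.2 v}

/-- The Aharonov-Bohm magnetic Dirichlet Laplacian `H_{ω,θ}`, the operator associated with
`Q_{ω,θ}`, as an unbounded operator in `L²_cyl(Lay(θ))`. The set `assocGraph ω θ` is already a
linear subspace, so that the linear span only serves to bundle it. -/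
def opH (ω : S1 → ℝ) (θ : ℝ) : L2 θ →ₗ.[ℂ] L2 θ :=
  (Submodule.span ℂ (assocGraph ω θ)).toLinearPMap

/-- The unitary map `U` transforms the unbounded operator `A` into `B`, i.e. `B = U A U⁻¹`,
domains included. -/
def Intertwines {θ : ℝ} (U : L2 θ ≃ₗᵢ[ℂ] L2 θ) (A B : L2 θ →ₗ.[ℂ] L2 θ) : Prop :=
  (B.domain : Set (L2 θ)) = U '' (A.domain : Set (L2 θ)) ∧
    ∀ (x : A.domain) (y : B.domain), (y : L2 θ) = U x → B y = U (A x)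

/-- Unitary equivalence of unbounded operators. -/
def UnitarilyEquivalent {θ : ℝ} (A B : L2 θ →ₗ.[ℂ] L2 θ) : Prop :=
  ∃ U : L2 θ ≃ₗᵢ[ℂ] L2 θ, Intertwines U A B

/-- The magnetic flux `Φ_ω`. -/
def flux (ω : S1 → ℝ) : ℝ := (2 * Real.pi)⁻¹ * ∫ ξ in (0 : ℝ)..(2 * Real.pi), ω (ξ : S1)

/-- `V(φ) = (Φ_ω + k) φ - ∫_0^φ ω`. -/
def gaugeV (ω : S1 → ℝ) (k : ℤ) (φ : ℝ) : ℝ :=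
  (flux ω + k) * φ - ∫ ξ in (0 : ℝ)..φ, ω (ξ : S1)

/-- The constant `Φ_ω + k` as a function on the circle. -/
def constFlux (ω : S1 → ℝ) (k : ℤ) : S1 → ℝ := fun _ => flux ω + k

/-- The function `e^{iV}` on `S¹`, the angle being taken in `[0, 2π)`. -/
def gaugeFactor (ω : S1 → ℝ) (k : ℤ) (x : S1) : ℂ :=
  Complex.exp (Complex.I * (gaugeV ω k (AddCircle.equivIco (2 * Real.pi) 0 x : ℝ) : ℂ))

theorem norm_gaugeFactor (ω : S1 → ℝ) (k : ℤ) (x : S1) : ‖gaugeFactor ω k x‖ = 1 := by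
  rw [gaugeFactor, mul_comm]
  exact Complex.norm_exp_ofReal_mul_I _

theorem measurable_gaugeFactor {ω : S1 → ℝ} (hω : MemLp ω 2 volume) (k : ℤ) :
    Measurable (gaugeFactor ω k) := by
  have h1 : Integrable ω volume := hω.integrable (by norm_num)
  have hp : Function.Periodic (fun ξ : ℝ => ω (ξ : S1)) (2 * Real.pi) := fun ξ => by simp
  have h2 : IntervalIntegrable (fun ξ : ℝ => ω (ξ : S1)) volume 0 (0 + 2 * Real.pi) := by
    rw [intervalIntegrable_iff_integrableOn_Ioc_of_le (by linarith [Real.two_pi_pos])]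
    exact (AddCircle.measurePreserving_mk (2 * Real.pi) 0).integrable_comp_of_integrable h1
  have hc : Continuous (gaugeV ω k) := by
    unfold gaugeV
    exact (continuous_const.mul continuous_id).sub (intervalIntegral.continuous_primitive
      (fun a b => hp.intervalIntegrable Real.two_pi_pos.ne' h2 a b) 0)
  have hm : Measurable fun x : S1 => (AddCircle.equivIco (2 * Real.pi) 0 x : ℝ) :=
    measurable_subtype_coe.comp (AddCircle.measurableEquivIco (2 * Real.pi) 0).measurable
  have := hc.measurable.comp hm
  unfold gaugeFactor
  fun_prop

/-- Multiplication by a measurable function of modulus one, on `L²_cyl(Lay(θ))`. -/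
def mulFun {θ : ℝ} (g : Cyl → ℂ) (hg : Measurable g) (hn : ∀ p, ‖g p‖ = 1) (u : L2 θ) : L2 θ :=
  MemLp.toLp (fun p => g p * u p)
    ((Lp.memLp u).of_le (hg.aestronglyMeasurable.mul (Lp.aestronglyMeasurable u))
      (ae_of_all _ fun p => by simp [hn]))

theorem coeFn_mulFun {θ : ℝ} (g : Cyl → ℂ) (hg : Measurable g) (hn : ∀ p, ‖g p‖ = 1) (u : L2 θ) :
    mulFun g hg hn u =ᵐ[cylMeasure θ] fun p => g p * u p :=
  MemLp.coeFn_toLp _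

/-- Multiplication by a measurable function of modulus one as a unitary operator. -/
def mulUnitary (θ : ℝ) (g : Cyl → ℂ) (hg : Measurable g) (hn : ∀ p, ‖g p‖ = 1) :
    L2 θ ≃ₗᵢ[ℂ] L2 θ where
  toFun := mulFun g hg hn
  invFun := mulFun (fun p => (g p)⁻¹) hg.inv (fun p => by simp [hn])
  map_add' u v := by
    apply Lp.ext
    filter_upwards [coeFn_mulFun g hg hn (u + v), coeFn_mulFun g hg hn u, coeFn_mulFun g hg hn v,
      Lp.coeFn_add u v, Lp.coeFn_add (mulFun g hg hn u) (mulFun g hg hn v)] with p h1 h2 h3 h4 h5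
    rw [h1, h5, Pi.add_apply, h2, h3, h4, Pi.add_apply, mul_add]
  map_smul' c u := by
    apply Lp.ext
    filter_upwards [coeFn_mulFun g hg hn (c • u), coeFn_mulFun g hg hn u,
      Lp.coeFn_smul c u, Lp.coeFn_smul c (mulFun g hg hn u)] with p h1 h2 h3 h4
    simp only [RingHom.id_apply]
    rw [h1, h4, Pi.smul_apply, h2, h3, Pi.smul_apply, smul_eq_mul, smul_eq_mul]
    ring
  left_inv u := by
    apply Lp.ext
    filter_upwards [coeFn_mulFun (fun p => (g p)⁻¹) hg.inv (fun p => by simp [hn])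
      (mulFun g hg hn u), coeFn_mulFun g hg hn u] with p h1 h2
    have h0 : g p ≠ 0 := fun h => by simpa [h] using hn p
    rw [h1, h2, inv_mul_cancel_left₀ h0]
  right_inv u := by
    apply Lp.ext
    filter_upwards [coeFn_mulFun (fun p => (g p)⁻¹) hg.inv (fun p => by simp [hn]) u,
      coeFn_mulFun g hg hn (mulFun (fun p => (g p)⁻¹) hg.inv (fun p => by simp [hn]) u)]
      with p h1 h2
    have h0 : g p ≠ 0 := fun h => by simpa [h] using hn p
    rw [h2, h1, mul_inv_cancel_left₀ h0]
  norm_map' u := by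
    change ‖mulFun g hg hn u‖ = ‖u‖
    rw [Lp.norm_def, Lp.norm_def]
    congr 1
    apply eLpNorm_congr_norm_ae
    filter_upwards [coeFn_mulFun g hg hn u] with p h1
    rw [h1, norm_mul, hn, one_mul]

/-- The gauge transform `G_V u = e^{iV} u`, a unitary operator in `L²_cyl(Lay(θ))`. -/
def gaugeTransform (θ : ℝ) {ω : S1 → ℝ} (hω : MemLp ω 2 volume) (k : ℤ) : L2 θ ≃ₗᵢ[ℂ] L2 θ :=
  mulUnitary θ (fun p => gaugeFactor ω k p.2.2)
    ((measurable_gaugeFactor hω k).comp (measurable_snd.comp measurable_snd))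
    (fun p => norm_gaugeFactor ω k p.2.2)

end ConicalLayer

end

/-! Formally, multiplication by `e^{iV}` turns the angular momentum with constant flux `Φ_ω + k`
into the one with `ω`, because `V' = Φ_ω + k - ω`, and `e^{iV}` closes up on the circle because `V`
grows by `2πk` over one turn. The obstacle is regularity: `ω` is only square-integrable, so `e^{iV}`
need not be smooth and `e^{iV} u` need not be a test function. The identity therefore has to be
proved in the closure.

The form is written as `‖∇_ω u‖²`, and the closure of the graph of `∇_ω` on test functions
(`formGraph`) replaces Cauchy sequences. It is again a graph (`formGraph_eq_zero`): each component
of `∇_ω` has a formal adjoint on test functions (`exists_adjoint`), and test functions are total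
(`eq_zero_of_forall_isTest`). Then `u` lies in the form domain exactly when some `(u, X)` lies in
this graph, and the closed form is `⟨X, Y⟩`. Consequently, if unitaries `U` and `W` map one graph
onto another (`FormEquiv`), then form domains, forms and associated operators are all transported by
`U`.

For the gauge transform, `Φ_ω + k - ω` is approximated in `L²(S¹)` by smooth `η` with the same
integral `2πk`. The functions `h = exp(i∫η)` are then smooth on the circle, of modulus one, and
uniformly close to `e^{iV}`. For a test function `u`, `h u` is a test function and `∇_ω(h u)`
differs from `h ∇_{Φ_ω+k} u` by an angular error controlled by the `L²` distance of `η` to `Φ_ω + k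
- ω`. In the limit `e^{iV}` maps one graph into the other (`gauge_mem_formGraph`), and the inverse
factor is treated by the same argument.

For the last claim, an integer shift brings the flux into `[-1/2, 1/2]`, and the reflection `φ ↦ -φ`
changes its sign. -/

open MeasureTheory Filter Topology Set

noncomputable section

namespace ConicalLayer

/-! ### Smooth functions and partial derivatives in cylindrical coordinates -/

/-- The function `u` in the coordinates `(r, z, t)` with `t` in the universal cover of `S¹`. -/
def lift3 (u : Cyl → ℂ) (q : ℝ × ℝ × ℝ) : ℂ := u (q.1, q.2.1, (q.2.2 : S1))

/-- Smoothness in the coordinates `r, z, φ`. -/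
def SmoothCyl (u : Cyl → ℂ) : Prop := ContDiff ℝ ((⊤ : ℕ∞) : WithTop ℕ∞) (lift3 u)

/-- The covering map `(r, z, t) ↦ (r, z, t mod 2π)`. -/
def cover (q : ℝ × ℝ × ℝ) : Cyl := (q.1, q.2.1, (q.2.2 : S1))

theorem isOpenQuotientMap_cover : IsOpenQuotientMap cover :=
  IsOpenQuotientMap.id.prodMap (IsOpenQuotientMap.id.prodMap QuotientAddGroup.isOpenQuotientMap_mk)

theorem cover_surjective (p : Cyl) : ∃ q, cover q = p := isOpenQuotientMap_cover.surjective p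

theorem SmoothCyl.continuous {u : Cyl → ℂ} (hu : SmoothCyl u) : Continuous u := by
  rw [← isOpenQuotientMap_cover.continuous_comp_iff]
  exact ContDiff.continuous hu

theorem IsTest.smooth {θ : ℝ} {u : Cyl → ℂ} (hu : IsTest θ u) : SmoothCyl u := hu.1

theorem IsTest.continuous {θ : ℝ} {u : Cyl → ℂ} (hu : IsTest θ u) : Continuous u :=
  hu.smooth.continuous

theorem SmoothCyl.mul {u v : Cyl → ℂ} (hu : SmoothCyl u) (hv : SmoothCyl v) :
    SmoothCyl (fun p => u p * v p) := ContDiff.mul hu hv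

theorem SmoothCyl.add {u v : Cyl → ℂ} (hu : SmoothCyl u) (hv : SmoothCyl v) :
    SmoothCyl (fun p => u p + v p) := ContDiff.add hu hv

theorem SmoothCyl.conj {u : Cyl → ℂ} (hu : SmoothCyl u) :
    SmoothCyl (fun p => (starRingEnd ℂ) (u p)) :=
  Complex.conjCLE.contDiff.comp hu

theorem smoothCyl_const (c : ℂ) : SmoothCyl (fun _ => c) := contDiff_const

theorem smoothCyl_radius : SmoothCyl (fun p => (p.1 : ℂ)) :=
  Complex.ofRealCLM.contDiff.comp contDiff_fst

theorem SmoothCyl.hasDerivAt_dr {u : Cyl → ℂ} (hu : SmoothCyl u) (p : Cyl) :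
    HasDerivAt (fun r : ℝ => u (r, p.2.1, p.2.2)) (dr u p) p.1 := by
  obtain ⟨⟨r, z, t⟩, rfl⟩ := cover_surjective p
  have h : Differentiable ℝ (lift3 u) := ContDiff.differentiable hu (by simp)
  have h2 : DifferentiableAt ℝ (fun s : ℝ => lift3 u (s, z, t)) r := by fun_prop
  exact h2.hasDerivAt

theorem SmoothCyl.hasDerivAt_dz {u : Cyl → ℂ} (hu : SmoothCyl u) (p : Cyl) :
    HasDerivAt (fun z : ℝ => u (p.1, z, p.2.2)) (dz u p) p.2.1 := by
  obtain ⟨⟨r, z, t⟩, rfl⟩ := cover_surjective p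
  have h : Differentiable ℝ (lift3 u) := ContDiff.differentiable hu (by simp)
  have h2 : DifferentiableAt ℝ (fun s : ℝ => lift3 u (r, s, t)) z := by fun_prop
  exact h2.hasDerivAt

theorem SmoothCyl.hasDerivAt_dphi_zero {u : Cyl → ℂ} (hu : SmoothCyl u) (p : Cyl) :
    HasDerivAt (fun s : ℝ => u (p.1, p.2.1, p.2.2 + (s : S1))) (dphi u p) 0 := by
  obtain ⟨⟨r, z, t⟩, rfl⟩ := cover_surjective p
  have h : Differentiable ℝ (lift3 u) := ContDiff.differentiable hu (by simp)
  have h2 : DifferentiableAt ℝ (fun s : ℝ => lift3 u (r, z, t + s)) 0 := by fun_prop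
  have h3 : (fun s : ℝ => lift3 u (r, z, t + s)) =
      fun s : ℝ => u ((cover (r, z, t)).1, (cover (r, z, t)).2.1,
        (cover (r, z, t)).2.2 + (s : S1)) := by
    funext s; simp [lift3, cover]
  rw [h3] at h2
  exact h2.hasDerivAt

theorem SmoothCyl.hasDerivAt_dphi {u : Cyl → ℂ} (hu : SmoothCyl u) (r z t : ℝ) :
    HasDerivAt (fun s : ℝ => u (r, z, (s : S1))) (dphi u (r, z, (t : S1))) t := by
  have h := hu.hasDerivAt_dphi_zero (r, z, (t : S1))
  have h2 : HasDerivAt (fun s : ℝ => s - t) 1 t := (hasDerivAt_id t).sub_const t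
  rw [← sub_self t] at h
  have h3 := HasDerivAt.scomp (h := fun s : ℝ => s - t) t h h2
  simp only [one_smul] at h3
  refine h3.congr_of_eventuallyEq (Eventually.of_forall fun s => ?_)
  simp [Function.comp]

theorem lift3_dr {u : Cyl → ℂ} (hu : SmoothCyl u) :
    lift3 (dr u) = fun q => fderiv ℝ (lift3 u) q (1, 0, 0) := by
  funext ⟨r, z, t⟩
  have h : DifferentiableAt ℝ (lift3 u) (r, z, t) := (ContDiff.differentiable hu (by simp)) _
  have h2 : HasDerivAt (fun s : ℝ => ((s, z, t) : ℝ × ℝ × ℝ)) (1, 0, 0) r :=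
    (hasDerivAt_id r).prodMk ((hasDerivAt_const r z).prodMk (hasDerivAt_const r t))
  exact (HasFDerivAt.comp_hasDerivAt r (f := fun s : ℝ => ((s, z, t) : ℝ × ℝ × ℝ))
    h.hasFDerivAt h2).deriv

theorem lift3_dz {u : Cyl → ℂ} (hu : SmoothCyl u) :
    lift3 (dz u) = fun q => fderiv ℝ (lift3 u) q (0, 1, 0) := by
  funext ⟨r, z, t⟩
  have h : DifferentiableAt ℝ (lift3 u) (r, z, t) := (ContDiff.differentiable hu (by simp)) _
  have h2 : HasDerivAt (fun s : ℝ => ((r, s, t) : ℝ × ℝ × ℝ)) (0, 1, 0) z :=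
    (hasDerivAt_const z r).prodMk ((hasDerivAt_id z).prodMk (hasDerivAt_const z t))
  exact (HasFDerivAt.comp_hasDerivAt z (f := fun s : ℝ => ((r, s, t) : ℝ × ℝ × ℝ))
    h.hasFDerivAt h2).deriv

theorem lift3_dphi {u : Cyl → ℂ} (hu : SmoothCyl u) :
    lift3 (dphi u) = fun q => fderiv ℝ (lift3 u) q (0, 0, 1) := by
  funext ⟨r, z, t⟩
  have h : DifferentiableAt ℝ (lift3 u) (r, z, t) := (ContDiff.differentiable hu (by simp)) _
  have h2 : HasDerivAt (fun s : ℝ => ((r, z, s) : ℝ × ℝ × ℝ)) (0, 0, 1) t :=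
    (hasDerivAt_const t r).prodMk ((hasDerivAt_const t z).prodMk (hasDerivAt_id t))
  exact (hu.hasDerivAt_dphi r z t).unique
    (HasFDerivAt.comp_hasDerivAt t (f := fun s : ℝ => ((r, z, s) : ℝ × ℝ × ℝ)) h.hasFDerivAt h2)

theorem SmoothCyl.contDiff_fderiv {u : Cyl → ℂ} (hu : SmoothCyl u) (v : ℝ × ℝ × ℝ) :
    ContDiff ℝ ((⊤ : ℕ∞) : WithTop ℕ∞) (fun q => fderiv ℝ (lift3 u) q v) :=
  (ContDiff.fderiv_right hu (by simp)).clm_apply contDiff_const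

protected theorem SmoothCyl.dr {u : Cyl → ℂ} (hu : SmoothCyl u) : SmoothCyl (dr u) := by
  rw [SmoothCyl, lift3_dr hu]; exact hu.contDiff_fderiv _

protected theorem SmoothCyl.dz {u : Cyl → ℂ} (hu : SmoothCyl u) : SmoothCyl (dz u) := by
  rw [SmoothCyl, lift3_dz hu]; exact hu.contDiff_fderiv _

protected theorem SmoothCyl.dphi {u : Cyl → ℂ} (hu : SmoothCyl u) : SmoothCyl (dphi u) := by
  rw [SmoothCyl, lift3_dphi hu]; exact hu.contDiff_fderiv _

/-! ### Stability of test functions and rules of differentiation -/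

theorem isTest_of_support {θ : ℝ} {u v : Cyl → ℂ} (hu : IsTest θ u) (hv : SmoothCyl v)
    (h : ∀ p, p ∉ tsupport u → v p = 0) : IsTest θ v := by
  have hs : tsupport v ⊆ tsupport u :=
    closure_minimal (fun p hp => by_contra fun h' => hp (h p h')) (isClosed_tsupport u)
  exact ⟨hv, hu.2.1.of_isClosed_subset (isClosed_tsupport v) hs, hs.trans hu.2.2⟩

theorem dr_eq_zero {u : Cyl → ℂ} {p : Cyl} (hp : p ∉ tsupport u) : dr u p = 0 := by
  have h := notMem_tsupport_iff_eventuallyEq.1 hp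
  have hc : Tendsto (fun r : ℝ => ((r, p.2.1, p.2.2) : Cyl)) (𝓝 p.1) (𝓝 p) :=
    Continuous.tendsto' (by fun_prop) _ _ rfl
  have h2 : (fun r : ℝ => u (r, p.2.1, p.2.2)) =ᶠ[𝓝 p.1] fun _ => 0 := hc.eventually h
  rw [dr, h2.deriv_eq, deriv_const]

theorem dz_eq_zero {u : Cyl → ℂ} {p : Cyl} (hp : p ∉ tsupport u) : dz u p = 0 := by
  have h := notMem_tsupport_iff_eventuallyEq.1 hp
  have hc : Tendsto (fun r : ℝ => ((p.1, r, p.2.2) : Cyl)) (𝓝 p.2.1) (𝓝 p) :=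
    Continuous.tendsto' (by fun_prop) _ _ rfl
  have h2 : (fun r : ℝ => u (p.1, r, p.2.2)) =ᶠ[𝓝 p.2.1] fun _ => 0 := hc.eventually h
  rw [dz, h2.deriv_eq, deriv_const]

theorem dphi_eq_zero {u : Cyl → ℂ} {p : Cyl} (hp : p ∉ tsupport u) : dphi u p = 0 := by
  have h := notMem_tsupport_iff_eventuallyEq.1 hp
  have hc : Tendsto (fun s : ℝ => ((p.1, p.2.1, p.2.2 + (s : S1)) : Cyl)) (𝓝 0) (𝓝 p) :=
    Continuous.tendsto' (by
      have : Continuous (fun s : ℝ => (s : S1)) := AddCircle.continuous_mk' _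
      fun_prop) _ _ (by simp)
  have h2 : (fun s : ℝ => u (p.1, p.2.1, p.2.2 + (s : S1))) =ᶠ[𝓝 0] fun _ => 0 := hc.eventually h
  rw [dphi, h2.deriv_eq, deriv_const]

section

variable {θ : ℝ} {u v : Cyl → ℂ}

protected theorem IsTest.dr (hu : IsTest θ u) : IsTest θ (dr u) :=
  isTest_of_support hu hu.smooth.dr fun _ => dr_eq_zero

protected theorem IsTest.dz (hu : IsTest θ u) : IsTest θ (dz u) :=
  isTest_of_support hu hu.smooth.dz fun _ => dz_eq_zero

protected theorem IsTest.dphi (hu : IsTest θ u) : IsTest θ (dphi u) :=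
  isTest_of_support hu hu.smooth.dphi fun _ => dphi_eq_zero

theorem IsTest.smooth_mul (hv : IsTest θ v) (hu : SmoothCyl u) : IsTest θ (fun p => u p * v p) :=
  isTest_of_support hv (hu.mul hv.smooth) fun p hp => by
    rw [image_eq_zero_of_notMem_tsupport hp, mul_zero]

theorem IsTest.conj (hu : IsTest θ u) : IsTest θ (fun p => (starRingEnd ℂ) (u p)) :=
  isTest_of_support hu hu.smooth.conj fun p hp => by
    rw [image_eq_zero_of_notMem_tsupport hp, map_zero]

theorem isTest_zero : IsTest θ (fun _ => 0) :=
  ⟨contDiff_const, HasCompactSupport.zero, by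
    rw [show (fun _ : Cyl => (0 : ℂ)) = 0 from rfl, tsupport_zero]; exact empty_subset _⟩

theorem IsTest.add (hu : IsTest θ u) (hv : IsTest θ v) : IsTest θ (fun p => u p + v p) :=
  ⟨hu.smooth.add hv.smooth, hu.2.1.add hv.2.1,
    (tsupport_add u v).trans (union_subset hu.2.2 hv.2.2)⟩

theorem IsTest.const_mul (hu : IsTest θ u) (c : ℂ) : IsTest θ (fun p => c * u p) :=
  hu.smooth_mul (smoothCyl_const c)

theorem Lay.radius_pos {p : Cyl} (hp : p ∈ Lay θ) : 0 < p.1 := hp.1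

theorem IsTest.eq_zero (hu : IsTest θ u) {p : Cyl} (hp : p ∉ Lay θ) : u p = 0 :=
  image_eq_zero_of_notMem_tsupport fun h => hp (hu.2.2 h)

/-- The support of `u` stays inside `r > 0`, where `1/r` is smooth, and the quotient vanishes near
every point off the support. -/
theorem IsTest.div_radius (hu : IsTest θ u) : IsTest θ (fun p => u p / (p.1 : ℂ)) := by
  refine isTest_of_support hu ?_ fun p hp => by
    rw [image_eq_zero_of_notMem_tsupport hp, zero_div]
  refine contDiff_iff_contDiffAt.2 fun q => ?_
  by_cases hq : cover q ∈ tsupport u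
  · have hr : (q.1 : ℂ) ≠ 0 := by
      have : 0 < q.1 := (hu.2.2 hq).1
      exact_mod_cast this.ne'
    have h1 : ContDiff ℝ ((⊤ : ℕ∞) : WithTop ℕ∞) (lift3 u) := hu.smooth
    have h2 : ContDiff ℝ ((⊤ : ℕ∞) : WithTop ℕ∞) (lift3 fun p => (p.1 : ℂ)) := smoothCyl_radius
    simp only [div_eq_mul_inv]
    exact h1.contDiffAt.mul (h2.contDiffAt.inv hr)
  · have h := notMem_tsupport_iff_eventuallyEq.1 hq
    have h2 := isOpenQuotientMap_cover.continuous.continuousAt.eventually h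
    refine (contDiffAt_const (c := (0 : ℂ))).congr_of_eventuallyEq ?_
    filter_upwards [h2] with x hx
    have hx' : u (x.1, x.2.1, (x.2.2 : S1)) = 0 := hx
    simp [lift3, hx']

theorem isOpen_Gui : IsOpen (Gui θ) := by
  simp only [Gui, Set.ofPred_and]
  refine IsOpen.inter ?_ (IsOpen.inter ?_ (IsOpen.inter ?_ ?_)) <;>
    apply isOpen_lt <;> fun_prop

theorem isOpen_Lay : IsOpen (Lay θ) :=
  isOpen_Gui.preimage (f := fun p : Cyl => (p.1, p.2.1)) (by fun_prop)

theorem dr_mul (hu : SmoothCyl u) (hv : SmoothCyl v) (p : Cyl) :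
    dr (fun p => u p * v p) p = dr u p * v p + u p * dr v p :=
  ((hu.hasDerivAt_dr p).mul (hv.hasDerivAt_dr p)).deriv

theorem dz_mul (hu : SmoothCyl u) (hv : SmoothCyl v) (p : Cyl) :
    dz (fun p => u p * v p) p = dz u p * v p + u p * dz v p :=
  ((hu.hasDerivAt_dz p).mul (hv.hasDerivAt_dz p)).deriv

theorem dphi_mul (hu : SmoothCyl u) (hv : SmoothCyl v) (p : Cyl) :
    dphi (fun p => u p * v p) p = dphi u p * v p + u p * dphi v p := by
  have := ((hu.hasDerivAt_dphi_zero p).mul (hv.hasDerivAt_dphi_zero p)).deriv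
  simp only [AddCircle.coe_zero, add_zero] at this
  exact this

theorem dr_add (hu : SmoothCyl u) (hv : SmoothCyl v) (p : Cyl) :
    dr (fun p => u p + v p) p = dr u p + dr v p :=
  ((hu.hasDerivAt_dr p).add (hv.hasDerivAt_dr p)).deriv

theorem dz_add (hu : SmoothCyl u) (hv : SmoothCyl v) (p : Cyl) :
    dz (fun p => u p + v p) p = dz u p + dz v p :=
  ((hu.hasDerivAt_dz p).add (hv.hasDerivAt_dz p)).deriv

theorem dphi_add (hu : SmoothCyl u) (hv : SmoothCyl v) (p : Cyl) :
    dphi (fun p => u p + v p) p = dphi u p + dphi v p :=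
  ((hu.hasDerivAt_dphi_zero p).add (hv.hasDerivAt_dphi_zero p)).deriv

theorem dr_conj (hu : SmoothCyl u) (p : Cyl) :
    dr (fun p => (starRingEnd ℂ) (u p)) p = (starRingEnd ℂ) (dr u p) :=
  (hu.hasDerivAt_dr p).star.deriv

theorem dz_conj (hu : SmoothCyl u) (p : Cyl) :
    dz (fun p => (starRingEnd ℂ) (u p)) p = (starRingEnd ℂ) (dz u p) :=
  (hu.hasDerivAt_dz p).star.deriv

theorem dphi_conj (hu : SmoothCyl u) (p : Cyl) :
    dphi (fun p => (starRingEnd ℂ) (u p)) p = (starRingEnd ℂ) (dphi u p) :=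
  (hu.hasDerivAt_dphi_zero p).star.deriv

end

theorem dr_const (c : ℂ) (p : Cyl) : dr (fun _ => c) p = 0 := by simp [dr]
theorem dz_const (c : ℂ) (p : Cyl) : dz (fun _ => c) p = 0 := by simp [dz]
theorem dphi_const (c : ℂ) (p : Cyl) : dphi (fun _ => c) p = 0 := by simp [dphi]

theorem dz_radius (p : Cyl) : dz (fun p => (p.1 : ℂ)) p = 0 := by simp [dz]

theorem dr_radius (p : Cyl) : dr (fun p => (p.1 : ℂ)) p = 1 :=
  (hasDerivAt_id p.1).ofReal_comp.deriv

/-! ### Integration on the layer: integrals of derivatives and angular multipliers -/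

section

variable {θ : ℝ} {u v : Cyl → ℂ}

theorem cylMeasure_absolutelyContinuous : cylMeasure θ ≪ volume :=
  Measure.restrict_le_self.absolutelyContinuous.trans (withDensity_absolutelyContinuous _ _)

instance : IsLocallyFiniteMeasure (cylMeasure θ) := by
  have : IsLocallyFiniteMeasure
      ((volume : Measure Cyl).withDensity fun p => ENNReal.ofReal p.1) :=
    IsLocallyFiniteMeasure.withDensity_ofReal continuous_fst
  unfold cylMeasure
  infer_instance

theorem measurableSet_Lay : MeasurableSet (Lay θ) := isOpen_Lay.measurableSet

theorem IsTest.memLp (hu : IsTest θ u) : MemLp u 2 (cylMeasure θ) :=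
  hu.continuous.memLp_of_hasCompactSupport hu.2.1

theorem IsTest.integrable (hu : IsTest θ u) : Integrable u :=
  hu.continuous.integrable_of_hasCompactSupport hu.2.1

/-- Passing to the unweighted product measure makes Fubini available for integration by parts. -/
theorem integral_cylMeasure {f : Cyl → ℂ} (hf : ∀ p ∉ Lay θ, f p = 0) :
    ∫ p, f p ∂(cylMeasure θ) = ∫ p : Cyl, (p.1 : ℂ) * f p := by
  rw [cylMeasure, restrict_withDensity measurableSet_Lay,
    integral_withDensity_eq_integral_toReal_smul (by fun_prop) (by simp),
    setIntegral_eq_integral_of_forall_compl_eq_zero (fun p hp => by rw [hf p hp, smul_zero])]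
  refine integral_congr_ae (ae_of_all _ fun p => ?_)
  by_cases hp : p ∈ Lay θ
  · simp [ENNReal.toReal_ofReal (Lay.radius_pos hp).le]
  · simp [hf p hp]

/-- Integrate first along the lines on which only `r` varies, where compact support kills the
boundary terms. -/
theorem IsTest.integral_dr (hu : IsTest θ u) : ∫ p : Cyl, dr u p = 0 := by
  have hi : Integrable (dr u) ((volume : Measure ℝ).prod (volume : Measure (ℝ × S1))) :=
    hu.dr.integrable
  change ∫ p, dr u p ∂((volume : Measure ℝ).prod (volume : Measure (ℝ × S1))) = 0
  rw [integral_prod_symm _ hi]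
  refine integral_eq_zero_of_ae (ae_of_all _ fun q => ?_)
  have hc : Topology.IsClosedEmbedding (fun r : ℝ => ((r, q) : Cyl)) :=
    (Isometry.of_dist_eq fun a b => by simp [Prod.dist_eq]).isClosedEmbedding
  have key : ∀ w : Cyl → ℂ, IsTest θ w → Integrable (fun r : ℝ => w (r, q)) := fun w hw =>
    (hw.continuous.comp hc.continuous).integrable_of_hasCompactSupport
      (hw.2.1.comp_isClosedEmbedding hc)
  exact integral_eq_zero_of_hasDerivAt_of_integrable
    (fun r => hu.smooth.hasDerivAt_dr (r, q)) (key _ hu.dr) (key _ hu)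

theorem IsTest.integral_dz (hu : IsTest θ u) : ∫ p : Cyl, dz u p = 0 := by
  have hi : Integrable (dz u) ((volume : Measure ℝ).prod (volume : Measure (ℝ × S1))) :=
    hu.dz.integrable
  change ∫ p, dz u p ∂((volume : Measure ℝ).prod (volume : Measure (ℝ × S1))) = 0
  rw [integral_prod _ hi]
  refine integral_eq_zero_of_ae ?_
  filter_upwards [hi.prod_right_ae] with r hr
  change ∫ q, dz u (r, q) ∂((volume : Measure ℝ).prod (volume : Measure S1)) = 0
  rw [integral_prod_symm _ hr]
  refine integral_eq_zero_of_ae (ae_of_all _ fun x => ?_)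
  have hc : Topology.IsClosedEmbedding (fun z : ℝ => ((r, z, x) : Cyl)) :=
    (Isometry.of_dist_eq fun a b => by simp [Prod.dist_eq]).isClosedEmbedding
  have key : ∀ w : Cyl → ℂ, IsTest θ w → Integrable (fun z : ℝ => w (r, z, x)) := fun w hw =>
    (hw.continuous.comp hc.continuous).integrable_of_hasCompactSupport
      (hw.2.1.comp_isClosedEmbedding hc)
  exact integral_eq_zero_of_hasDerivAt_of_integrable
    (fun z => hu.smooth.hasDerivAt_dz (r, z, x)) (key _ hu.dz) (key _ hu)

/-- Here it is periodicity that makes the boundary terms over one full turn cancel. -/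
theorem IsTest.integral_dphi (hu : IsTest θ u) : ∫ p : Cyl, dphi u p = 0 := by
  have hi : Integrable (dphi u)
      ((volume : Measure ℝ).prod (volume : Measure (ℝ × S1))) := hu.dphi.integrable
  change ∫ p, dphi u p ∂((volume : Measure ℝ).prod (volume : Measure (ℝ × S1))) = 0
  rw [integral_prod _ hi]
  refine integral_eq_zero_of_ae ?_
  filter_upwards [hi.prod_right_ae] with r hr
  change ∫ q, dphi u (r, q) ∂((volume : Measure ℝ).prod (volume : Measure S1)) = 0
  rw [integral_prod _ hr]
  refine integral_eq_zero_of_ae (ae_of_all _ fun z => ?_)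
  change ∫ x : S1, dphi u (r, z, x) = 0
  rw [← AddCircle.intervalIntegral_preimage (2 * Real.pi) 0,
    intervalIntegral.integral_eq_sub_of_hasDerivAt
      (fun t _ => hu.smooth.hasDerivAt_dphi r z t)]
  · simp [AddCircle.coe_period]
  · refine Continuous.intervalIntegrable ?_ _ _
    have h2 : Continuous (fun t : ℝ => (t : S1)) := AddCircle.continuous_mk' _
    exact hu.dphi.continuous.comp (by fun_prop)

/-- The angle as a map on `Cyl`. -/
def angle (p : Cyl) : S1 := p.2.2

theorem measurable_angle : Measurable angle := measurable_snd.comp measurable_snd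

theorem quasiMeasurePreserving_angle :
    Measure.QuasiMeasurePreserving angle (cylMeasure θ) volume :=
  (Measure.quasiMeasurePreserving_snd.comp
    Measure.quasiMeasurePreserving_snd : Measure.QuasiMeasurePreserving angle
      (volume : Measure Cyl) volume).mono_left cylMeasure_absolutelyContinuous

/-- A compact set lies in a box `B × B × S¹` on which the weight `r` is at most `R`, so integrating
out `r` and `z` costs only a constant. This lets a merely square-integrable function of the angle be
multiplied by a test function. -/
theorem map_angle_restrict_le {K : Set Cyl} (hK : IsCompact K) :
    ∃ c : NNReal, ((cylMeasure θ).restrict K).map angle ≤ c • (volume : Measure S1) := by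
  obtain ⟨R, hR⟩ := hK.isBounded.subset_closedBall (0 : Cyl)
  let B : Set ℝ := Metric.closedBall 0 R
  have hB : volume B < ⊤ := measure_closedBall_lt_top
  refine ⟨(ENNReal.ofReal R * (volume B * volume B)).toNNReal, ?_⟩
  rw [Measure.le_iff]
  intro A hA
  have hKB : ∀ p ∈ K, p.1 ∈ B ∧ p.2.1 ∈ B ∧ p.1 ≤ R := by
    intro p hp
    have h := hR hp
    rw [Metric.mem_closedBall, Prod.dist_eq, max_le_iff, Prod.dist_eq, max_le_iff] at h
    refine ⟨h.1, h.2.1, ?_⟩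
    have := h.1
    simp only [Prod.fst_zero, dist_zero_right, Real.norm_eq_abs] at this
    exact (le_abs_self _).trans this
  have hAm : MeasurableSet (angle ⁻¹' A) := measurable_angle hA
  rw [Measure.map_apply measurable_angle hA, Measure.restrict_apply hAm]
  have h1 : cylMeasure θ (angle ⁻¹' A ∩ K) ≤
      ∫⁻ p in angle ⁻¹' A ∩ K, ENNReal.ofReal p.1 := by
    rw [← withDensity_apply _ (hAm.inter hK.measurableSet)]
    exact Measure.restrict_le_self _
  have h2 : ∫⁻ p in angle ⁻¹' A ∩ K, ENNReal.ofReal p.1 ≤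
      ENNReal.ofReal R * volume (angle ⁻¹' A ∩ K) := by
    rw [← setLIntegral_const]
    exact setLIntegral_mono measurable_const
      fun p hp => ENNReal.ofReal_le_ofReal (hKB p hp.2).2.2
  have h3 : volume (angle ⁻¹' A ∩ K) ≤ volume B * (volume B * volume A) := by
    have : (volume : Measure Cyl) (B ×ˢ (B ×ˢ A)) = volume B * (volume B * volume A) := by
      rw [Measure.volume_eq_prod, Measure.prod_prod, Measure.volume_eq_prod, Measure.prod_prod]
    rw [← this]
    exact measure_mono fun p hp => ⟨(hKB p hp.2).1, (hKB p hp.2).2.1, hp.1⟩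
  refine (h1.trans h2).trans ((mul_le_mul_right h3 _).trans_eq ?_)
  rw [Measure.smul_apply, ENNReal.smul_def, ENNReal.coe_toNNReal
    (ENNReal.mul_ne_top ENNReal.ofReal_ne_top (ENNReal.mul_ne_top hB.ne hB.ne)), smul_eq_mul]
  ring

/-- Multiplication by a test function is bounded from `L²(S¹)` to `L²_cyl`. -/
theorem IsTest.exists_eLpNorm_mul_le (hu : IsTest θ u) :
    ∃ C : NNReal, ∀ η : S1 → ℝ, AEStronglyMeasurable η volume →
      eLpNorm (fun p => (η p.2.2 : ℂ) * u p) 2 (cylMeasure θ) ≤ C * eLpNorm η 2 volume := by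
  obtain ⟨M, hM⟩ := hu.continuous.bounded_above_of_compact_support hu.2.1
  obtain ⟨c, hc⟩ := map_angle_restrict_le (θ := θ) hu.2.1
  -- `M` bounds `u`; the measure bound `c` enters an `L²` norm through its square root.
  refine ⟨M.toNNReal * c ^ (1 / 2 : ℝ), fun η hη => ?_⟩
  have hs : Function.support (fun p : Cyl => (η p.2.2 : ℂ) * u p) ⊆ tsupport u := fun p hp =>
    subset_tsupport u (right_ne_zero_of_mul hp)
  rw [← eLpNorm_restrict_eq_of_support_subset hs]
  have h1 : eLpNorm (fun p => (η p.2.2 : ℂ) * u p) 2 ((cylMeasure θ).restrict (tsupport u)) ≤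
      ENNReal.ofReal M * eLpNorm (η ∘ angle) 2 ((cylMeasure θ).restrict (tsupport u)) := by
    refine eLpNorm_le_mul_eLpNorm_of_ae_le_mul (ae_of_all _ fun p => ?_) 2
    rw [norm_mul, Complex.norm_real, mul_comm]
    exact mul_le_mul_of_nonneg_right (hM p) (norm_nonneg _)
  have hη' : AEStronglyMeasurable η
      (((cylMeasure θ).restrict (tsupport u)).map angle) :=
    hη.mono_ac ((Measure.absolutelyContinuous_of_le hc).trans
      (Measure.smul_absolutelyContinuous))
  have h2 : eLpNorm (η ∘ angle) 2 ((cylMeasure θ).restrict (tsupport u)) ≤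
      (c ^ (1 / 2 : ℝ) : NNReal) * eLpNorm η 2 volume := by
    rw [← eLpNorm_map_measure hη' measurable_angle.aemeasurable]
    refine (eLpNorm_mono_measure _ hc).trans ?_
    rw [eLpNorm_smul_measure_of_ne_top' (by norm_num)]
    simp [ENNReal.smul_def]
  refine h1.trans ((mul_le_mul_right h2 _).trans_eq ?_)
  rw [ENNReal.coe_mul, mul_assoc]
  rfl

theorem IsTest.memLp_mul (hu : IsTest θ u) {η : S1 → ℝ} (hη : MemLp η 2 volume) :
    MemLp (fun p => (η p.2.2 : ℂ) * u p) 2 (cylMeasure θ) := by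
  obtain ⟨C, hC⟩ := hu.exists_eLpNorm_mul_le
  refine ⟨?_, (hC η hη.1).trans_lt (ENNReal.mul_lt_top ENNReal.coe_lt_top hη.2)⟩
  have h1 : AEStronglyMeasurable (fun p : Cyl => η p.2.2) (cylMeasure θ) :=
    hη.1.comp_quasiMeasurePreserving quasiMeasurePreserving_angle
  exact (Complex.continuous_ofReal.comp_aestronglyMeasurable h1).mul
    hu.continuous.aestronglyMeasurable

end

/-! ### Totality of test functions, by Fourier series in the angle -/

theorem volume_eq_haar :
    (volume : Measure S1) = ENNReal.ofReal (2 * Real.pi) • AddCircle.haarAddCircle :=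
  AddCircle.volume_eq_smul_haarAddCircle

theorem memLp_haar {E : Type*} [NormedAddCommGroup E] {f : S1 → E} (hf : MemLp f 2 volume) :
    MemLp f 2 (AddCircle.haarAddCircle : Measure S1) := by
  have hc : ENNReal.ofReal (2 * Real.pi) ≠ 0 := by simp [Real.pi_pos]
  have := hf.smul_measure (c := (ENNReal.ofReal (2 * Real.pi))⁻¹) (ENNReal.inv_ne_top.2 hc)
  rwa [volume_eq_haar, smul_smul, ENNReal.inv_mul_cancel hc ENNReal.ofReal_ne_top, one_smul] at this

/-- Completeness of the exponentials for the normalized Haar measure, carried over to `dφ`, which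
differs from it by the factor `2π`. -/
theorem ae_eq_zero_of_fourier {f : S1 → ℂ} (hf : MemLp f 2 volume)
    (h : ∀ n : ℤ, ∫ x, fourier (-n) x * f x = 0) : f =ᵐ[volume] 0 := by
  have hc : ENNReal.ofReal (2 * Real.pi) ≠ 0 := by simp [Real.pi_pos]
  have hf' := memLp_haar hf
  have h0 : hf'.toLp f = 0 := by
    apply fourierBasis.repr.injective
    rw [map_zero]
    ext n
    rw [fourierBasis_repr]
    have : fourierCoeff (hf'.toLp f) n = fourierCoeff f n :=
      integral_congr_ae (by filter_upwards [hf'.coeFn_toLp] with x hx; rw [hx])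
    rw [this, fourierCoeff]
    have h1 := h n
    rw [volume_eq_haar, integral_smul_measure, smul_eq_zero] at h1
    simpa using h1.resolve_left (ENNReal.toReal_ne_zero.2 ⟨hc, ENNReal.ofReal_ne_top⟩)
  have h1 : f =ᵐ[AddCircle.haarAddCircle] 0 := by
    have h2 := hf'.coeFn_toLp
    rw [h0] at h2
    exact h2.symm.trans (Lp.coeFn_zero _ _ _)
  rw [volume_eq_haar]
  exact Measure.ae_smul_measure h1 _

section

variable {θ : ℝ}

theorem integrable_cylMeasure_iff {E : Type*} [NormedAddCommGroup E] [NormedSpace ℝ E]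
    {φ : Cyl → E} :
    Integrable φ (cylMeasure θ) ↔ Integrable ((Lay θ).indicator fun p => p.1 • φ p) volume := by
  rw [cylMeasure, restrict_withDensity measurableSet_Lay,
    integrable_withDensity_iff_integrable_smul' (by fun_prop) (by simp),
    integrable_indicator_iff measurableSet_Lay, IntegrableOn]
  refine integrable_congr ?_
  filter_upwards [ae_restrict_mem measurableSet_Lay] with p hp
  rw [ENNReal.toReal_ofReal (Lay.radius_pos hp).le]

theorem measurePreserving_assoc :
    MeasurePreserving (MeasurableEquiv.prodAssoc : (ℝ × ℝ) × S1 ≃ᵐ Cyl)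
      ((volume : Measure (ℝ × ℝ)).prod (volume : Measure S1)) volume :=
  ⟨MeasurableEquiv.prodAssoc.measurable, Measure.prodAssoc_prod⟩

theorem integrable_assoc {E : Type*} [NormedAddCommGroup E] [NormedSpace ℝ E]
    {φ : Cyl → E} (h : Integrable φ (cylMeasure θ)) :
    Integrable (fun y : (ℝ × ℝ) × S1 => (Gui θ).indicator (fun q => q.1 • φ (q.1, q.2, y.2)) y.1)
      ((volume : Measure (ℝ × ℝ)).prod (volume : Measure S1)) := by
  refine (measurePreserving_assoc.integrable_comp_of_integrable
    (integrable_cylMeasure_iff.1 h)).congr (ae_of_all _ fun y => ?_)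
  obtain ⟨⟨r, z⟩, x⟩ := y
  by_cases hq : (r, z) ∈ Gui θ
  · have : ((r, z, x) : Cyl) ∈ Lay θ := hq
    simp [MeasurableEquiv.prodAssoc, hq, this]
  · have : ((r, z, x) : Cyl) ∉ Lay θ := hq
    simp [MeasurableEquiv.prodAssoc, hq, this]

theorem isCompact_tube {K : Set (ℝ × ℝ)} (hK : IsCompact K) :
    IsCompact {p : Cyl | (p.1, p.2.1) ∈ K} := by
  have := (hK.prod (isCompact_univ (X := S1))).image
    (f := fun y : (ℝ × ℝ) × S1 => ((y.1.1, y.1.2, y.2) : Cyl)) (by fun_prop)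
  refine this.of_isClosed_subset
    (hK.isClosed.preimage (f := fun p : Cyl => (p.1, p.2.1)) (by fun_prop)) ?_
  exact fun p hp => ⟨((p.1, p.2.1), p.2.2), ⟨hp, mem_univ _⟩, rfl⟩

/-- These separated functions are already enough for totality: `a` tests in the meridian domain and
the exponential extracts one angular mode. -/
theorem isTest_mul_fourier {a : ℝ × ℝ → ℝ} (ha : ContDiff ℝ ((⊤ : ℕ∞) : WithTop ℕ∞) a)
    (hc : HasCompactSupport a) (hs : tsupport a ⊆ Gui θ) (n : ℤ) :
    IsTest θ (fun p => (a (p.1, p.2.1) : ℂ) * fourier n p.2.2) := by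
  have hsub : tsupport (fun p : Cyl => (a (p.1, p.2.1) : ℂ) * fourier n p.2.2) ⊆
      {p : Cyl | (p.1, p.2.1) ∈ tsupport a} := by
    refine closure_minimal (fun p hp => subset_tsupport a fun h0 => hp ?_)
      ((isClosed_tsupport a).preimage (f := fun p : Cyl => (p.1, p.2.1)) (by fun_prop))
    have h0' : a (p.1, p.2.1) = 0 := h0
    simp [h0']
  have hK := isCompact_tube hc.isCompact
  refine ⟨?_, hK.of_isClosed_subset (isClosed_tsupport _) hsub, hsub.trans fun p hp => hs hp⟩
  refine ContDiff.mul ?_ ?_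
  · have h2 : ContDiff ℝ ((⊤ : ℕ∞) : WithTop ℕ∞) fun q : ℝ × ℝ × ℝ => (q.1, q.2.1) := by fun_prop
    exact Complex.ofRealCLM.contDiff.comp (ha.comp h2)
  · simp only [fourier_coe_apply]
    refine Complex.contDiff_exp.comp (ContDiff.div_const (contDiff_const.mul ?_) _)
    exact Complex.ofRealCLM.contDiff.comp (contDiff_snd.comp contDiff_snd)

theorem integrable_conj_mul {g : Cyl → ℂ} (hg : IsTest θ g) (F : L2 θ) :
    Integrable (fun p => (starRingEnd ℂ) (g p) * F p) (cylMeasure θ) :=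
  hg.conj.memLp.integrable_mul (Lp.memLp F)

/-- The angular Fourier coefficients of a function orthogonal to all test functions vanish. -/
theorem ae_fourier_eq_zero (F : L2 θ)
    (h : ∀ g, IsTest θ g → ∫ p, (starRingEnd ℂ) (g p) * F p ∂(cylMeasure θ) = 0) (n : ℤ) :
    ∀ᵐ q : ℝ × ℝ, q ∈ Gui θ → ∫ x : S1, fourier (-n) x * F (q.1, q.2, x) = 0 := by
  have hfour : ∀ x : S1, ‖fourier (-n) x‖ ≤ 1 := fun x => by
    rw [fourier_apply, Circle.norm_coe]
  -- Over a compact `K` in the meridian domain the tube `K × S¹` has finite measure, so `F` is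
  -- integrable there, and Fubini gives integrability of the angular coefficient on `K`.
  have hloc : LocallyIntegrableOn (fun q : ℝ × ℝ => ∫ x : S1,
      fourier (-n) x * (q.1 • F (q.1, q.2, x))) (Gui θ) := by
    rw [locallyIntegrableOn_iff isOpen_Gui.isLocallyClosed]
    intro K hKs hK
    have hK' := isCompact_tube hK
    have hfin : IsFiniteMeasure ((cylMeasure θ).restrict {p : Cyl | (p.1, p.2.1) ∈ K}) :=
      ⟨by rw [Measure.restrict_apply_univ]; exact hK'.measure_lt_top⟩
    have h1 : Integrable ({p : Cyl | (p.1, p.2.1) ∈ K}.indicator F) (cylMeasure θ) := by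
      rw [integrable_indicator_iff hK'.measurableSet]
      exact ((Lp.memLp F).restrict _).integrable (by norm_num)
    have h2 := (integrable_assoc h1).bdd_mul (c := 1)
      (f := fun y : (ℝ × ℝ) × S1 => fourier (-n) y.2)
      ((map_continuous (fourier (-n))).comp continuous_snd).aestronglyMeasurable
      (ae_of_all _ fun y => hfour y.2)
    have h3 := h2.integral_prod_left
    rw [← integrable_indicator_iff hK.measurableSet]
    refine h3.congr (ae_of_all _ fun q => ?_)
    by_cases hq : q ∈ K
    · have hq' := hKs hq
      simp [hq, hq', Set.indicator]
    · simp [hq, Set.indicator]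
  -- Tested against bump functions `a`, the angular coefficient integrates to zero by the hypothesis
  -- applied to `a(r,z)e^{inφ}`. The weight `r` is kept inside and divided out afterwards.
  have key := isOpen_Gui.ae_eq_zero_of_integral_contDiff_smul_eq_zero hloc (fun a ha hc hs => by
    have hg := isTest_mul_fourier (θ := θ) ha hc hs n
    have h1 := h _ hg
    have h2 := integrable_assoc (integrable_conj_mul hg F)
    rw [integral_cylMeasure (fun p hp => by rw [hg.eq_zero hp]; simp),
      ← measurePreserving_assoc.integral_comp MeasurableEquiv.prodAssoc.measurableEmbedding] at h1
    have h3 : (fun y : (ℝ × ℝ) × S1 => (Gui θ).indicator (fun q => q.1 •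
        ((starRingEnd ℂ) ((a (q.1, q.2) : ℂ) * fourier n y.2) * F (q.1, q.2, y.2))) y.1) =
        fun y => a y.1 • (fourier (-n) y.2 * (y.1.1 • F (y.1.1, y.1.2, y.2))) := by
      funext ⟨q, x⟩
      by_cases hq : q ∈ Gui θ
      · simp only [hq, indicator_of_mem, map_mul, Complex.conj_ofReal, fourier_neg,
          Complex.real_smul]
        ring
      · have : a q = 0 := image_eq_zero_of_notMem_tsupport fun h => hq (hs h)
        simp [hq, this]
    have h4 : (fun y : (ℝ × ℝ) × S1 => ((MeasurableEquiv.prodAssoc y : Cyl).1 : ℂ) *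
        ((starRingEnd ℂ) ((a ((MeasurableEquiv.prodAssoc y : Cyl).1,
          (MeasurableEquiv.prodAssoc y : Cyl).2.1) : ℂ) *
            fourier n (MeasurableEquiv.prodAssoc y : Cyl).2.2) * F (MeasurableEquiv.prodAssoc y))) =
        fun y => a y.1 • (fourier (-n) y.2 * (y.1.1 • F (y.1.1, y.1.2, y.2))) := by
      funext ⟨q, x⟩
      simp only [MeasurableEquiv.prodAssoc, MeasurableEquiv.coe_mk, Equiv.prodAssoc_apply,
        map_mul, Complex.conj_ofReal, fourier_neg, Complex.real_smul]
      ring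
    rw [h3] at h2
    rw [h4, integral_prod _ h2] at h1
    simp only [integral_smul] at h1
    exact h1)
  filter_upwards [key] with q hq hqG
  have h1 := hq hqG
  have hr : q.1 ≠ 0 := hqG.1.ne'
  simp only [Complex.real_smul, mul_left_comm _ (q.1 : ℂ), integral_const_mul, mul_eq_zero,
    Complex.ofReal_eq_zero, hr, false_or] at h1
  exact h1

/-- Test functions are total in `L²_cyl`. -/
theorem eq_zero_of_forall_isTest (F : L2 θ)
    (h : ∀ g, IsTest θ g → ∫ p, (starRingEnd ℂ) (g p) * F p ∂(cylMeasure θ) = 0) : F = 0 := by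
  -- There are countably many modes, so one null set of `(r, z)` serves them all.
  have h1 : ∀ᵐ q : ℝ × ℝ, ∀ n : ℤ, q ∈ Gui θ → ∫ x : S1, fourier (-n) x * F (q.1, q.2, x) = 0 :=
    ae_all_iff.2 fun n => ae_fourier_eq_zero F h n
  have hmeas : StronglyMeasurable F := Lp.stronglyMeasurable F
  have h2 := (integrable_assoc ((memLp_two_iff_integrable_sq_norm
    (Lp.aestronglyMeasurable F)).1 (Lp.memLp F))).prod_right_ae
  -- On almost every circle the slice of `F` is square-integrable with all Fourier coefficients
  -- zero, hence vanishes almost everywhere.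
  have h3 : ∀ᵐ q : ℝ × ℝ, ∀ᵐ x : S1, q ∈ Gui θ → F (q.1, q.2, x) = 0 := by
    filter_upwards [h1, h2] with q hq1 hq2
    by_cases hq : q ∈ Gui θ
    · have hr : q.1 ≠ 0 := hq.1.ne'
      simp only [hq, indicator_of_mem, smul_eq_mul] at hq2
      have hq3 : Integrable (fun x : S1 => ‖F (q.1, q.2, x)‖ ^ 2) := by
        simpa [hr] using hq2.const_mul (q.1)⁻¹
      have hm : StronglyMeasurable (fun x : S1 => F (q.1, q.2, x)) :=
        hmeas.comp_measurable (by fun_prop)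
      filter_upwards [ae_eq_zero_of_fourier
        ((memLp_two_iff_integrable_sq_norm hm.aestronglyMeasurable).2 hq3)
        fun n => hq1 n hq] with x hx _
      exact hx
    · simp [hq]
  have hset : MeasurableSet {y : (ℝ × ℝ) × S1 | y.1 ∈ Gui θ → F (y.1.1, y.1.2, y.2) = 0} := by
    have hA : MeasurableSet {y : (ℝ × ℝ) × S1 | y.1 ∈ Gui θ} :=
      measurable_fst isOpen_Gui.measurableSet
    have hB : MeasurableSet {y : (ℝ × ℝ) × S1 | F (y.1.1, y.1.2, y.2) = 0} :=
      (hmeas.measurable.comp (by fun_prop : Measurable fun y : (ℝ × ℝ) × S1 =>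
        ((y.1.1, y.1.2, y.2) : Cyl))) (measurableSet_singleton 0)
    exact hA.imp hB
  have h4 : ∀ᵐ y ∂((volume : Measure (ℝ × ℝ)).prod (volume : Measure S1)),
      y.1 ∈ Gui θ → F (y.1.1, y.1.2, y.2) = 0 :=
    (Measure.ae_prod_iff_ae_ae hset).2 h3
  have h5 : ∀ᵐ p : Cyl, p ∈ Lay θ → F p = 0 := by
    rw [← measurePreserving_assoc.map_eq, ae_map_iff measurePreserving_assoc.aemeasurable]
    · exact h4
    · exact measurableSet_Lay.imp (hmeas.measurable (measurableSet_singleton 0))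
  apply Lp.ext
  refine EventuallyEq.trans ?_ (Lp.coeFn_zero _ _ _).symm
  have h6 : ∀ᵐ p ∂((volume : Measure Cyl).withDensity fun p => ENNReal.ofReal p.1),
      p ∈ Lay θ → F p = 0 := (withDensity_absolutelyContinuous _ _).ae_le h5
  exact (ae_restrict_iff' measurableSet_Lay).2 h6

end

/-! ### The magnetic gradient as an operator on test functions, and its formal adjoint -/

section

variable {θ : ℝ} {ω : S1 → ℝ} {u v : Cyl → ℂ}

@[simp] theorem magGrad_zero (ω : S1 → ℝ) (u : Cyl → ℂ) (p : Cyl) :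
    magGrad ω u p 0 = Complex.I * dr u p := rfl

@[simp] theorem magGrad_one (ω : S1 → ℝ) (u : Cyl → ℂ) (p : Cyl) :
    magGrad ω u p 1 = Complex.I * (dphi u p / (p.1 : ℂ)) - ((ω p.2.2 / p.1 : ℝ) : ℂ) * u p := rfl

@[simp] theorem magGrad_two (ω : S1 → ℝ) (u : Cyl → ℂ) (p : Cyl) :
    magGrad ω u p 2 = Complex.I * dz u p := rfl

/-- Only the angular component involves `ω`. There `u/r` is again a test function, so `ω ∈ L²(S¹)`
suffices. -/
theorem memLp_magGrad (hω : MemLp ω 2 volume) (hu : IsTest θ u) (i : Fin 3) :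
    MemLp (fun p => magGrad ω u p i) 2 (cylMeasure θ) := by
  fin_cases i
  · exact hu.dr.memLp.const_mul Complex.I
  · refine ((hu.dphi.div_radius.memLp.const_mul Complex.I).sub
      (hu.div_radius.memLp_mul hω)).ae_eq (ae_of_all _ fun p => ?_)
    simp only [Pi.sub_apply, Fin.mk_one, magGrad_one]
    push_cast
    ring
  · exact hu.dz.memLp.const_mul Complex.I

theorem magGrad_add (hu : SmoothCyl u) (hv : SmoothCyl v) (p : Cyl) :
    magGrad ω (fun p => u p + v p) p = magGrad ω u p + magGrad ω v p := by
  ext i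
  fin_cases i
  · simp [dr_add hu hv]; ring
  · simp [dphi_add hu hv]; ring
  · simp [dz_add hu hv]; ring

theorem magGrad_const_mul (hu : SmoothCyl u) (c : ℂ) (p : Cyl) :
    magGrad ω (fun p => c * u p) p = c • magGrad ω u p := by
  ext i
  fin_cases i
  · simp [dr_mul (smoothCyl_const c) hu, dr_const]; ring
  · simp [dphi_mul (smoothCyl_const c) hu, dphi_const]; ring
  · simp [dz_mul (smoothCyl_const c) hu, dz_const]; ring

/-- The space `C₀^∞(Lay(θ))`. -/
def testSpace (θ : ℝ) : Submodule ℂ (Cyl → ℂ) where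
  carrier := {u | IsTest θ u}
  add_mem' hu hv := hu.add hv
  zero_mem' := isTest_zero
  smul_mem' c _ hu := hu.const_mul c

/-- The square-integrable `ℂ³`-valued functions. -/
abbrev Fld (θ : ℝ) : Type := PiLp 2 (fun _ : Fin 3 => L2 θ)

/-- The embedding of test functions in `L²_cyl`. -/
def testToL2 (θ : ℝ) : testSpace θ →ₗ[ℂ] L2 θ where
  toFun u := (IsTest.memLp u.2).toLp u
  map_add' _ _ := rfl
  map_smul' _ _ := rfl

/-- The magnetic gradient of a test function, as an element of `L²`. -/
def magLp (θ : ℝ) (hω : MemLp ω 2 volume) : testSpace θ →ₗ[ℂ] Fld θ where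
  toFun u := WithLp.toLp 2 fun i => (memLp_magGrad hω u.2 i).toLp _
  map_add' u v := by
    ext1 i
    refine ((MemLp.toLp_eq_toLp_iff (memLp_magGrad hω (u + v).2 i) _).2
      (ae_of_all _ fun p => ?_)).trans
      (MemLp.toLp_add (memLp_magGrad hω u.2 i) (memLp_magGrad hω v.2 i))
    exact congrArg (fun x : EuclideanSpace ℂ (Fin 3) => x i)
      (magGrad_add (IsTest.smooth u.2) (IsTest.smooth v.2) p)
  map_smul' c u := by
    ext1 i
    refine ((MemLp.toLp_eq_toLp_iff (memLp_magGrad hω (c • u).2 i) _).2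
      (ae_of_all _ fun p => ?_)).trans
      (MemLp.toLp_const_smul c (memLp_magGrad hω u.2 i))
    exact congrArg (fun x : EuclideanSpace ℂ (Fin 3) => x i)
      (magGrad_const_mul (IsTest.smooth u.2) c p)

theorem inner_toLp {f g : Cyl → ℂ} (hf : MemLp f 2 (cylMeasure θ)) (hg : MemLp g 2 (cylMeasure θ)) :
    inner ℂ (hf.toLp f) (hg.toLp g) = ∫ p, (starRingEnd ℂ) (f p) * g p ∂(cylMeasure θ) := by
  rw [L2.inner_def]
  refine integral_congr_ae ?_
  filter_upwards [hf.coeFn_toLp, hg.coeFn_toLp] with p h1 h2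
  rw [h1, h2, RCLike.inner_apply, mul_comm]

theorem integrable_conj_mul_of_memLp {f g : Cyl → ℂ} (hf : MemLp f 2 (cylMeasure θ))
    (hg : MemLp g 2 (cylMeasure θ)) :
    Integrable (fun p => (starRingEnd ℂ) (f p) * g p) (cylMeasure θ) := by
  have h : MemLp (fun p => (starRingEnd ℂ) (f p)) 2 (cylMeasure θ) := hf.star
  exact h.integrable_mul hg

theorem sesq0_eq_inner (hω : MemLp ω 2 volume) (u v : testSpace θ) :
    sesq0 ω θ u v = inner ℂ (magLp θ hω u) (magLp θ hω v) := by
  rw [PiLp.inner_apply, sesq0]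
  simp only [PiLp.inner_apply]
  rw [integral_finsetSum _ fun i _ => ?_]
  · refine Finset.sum_congr rfl fun i _ => ?_
    refine Eq.trans ?_ (inner_toLp (memLp_magGrad hω u.2 i) (memLp_magGrad hω v.2 i)).symm
    refine integral_congr_ae (ae_of_all _ fun p => ?_)
    simp only [RCLike.inner_apply, mul_comm]
  · refine (integrable_conj_mul_of_memLp (memLp_magGrad hω u.2 i)
      (memLp_magGrad hω v.2 i)).congr (ae_of_all _ fun p => ?_)
    simp only [RCLike.inner_apply, mul_comm]

theorem form0_eq_norm_sq (hω : MemLp ω 2 volume) (u : testSpace θ) :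
    form0 ω θ u = ‖magLp θ hω u‖ ^ 2 := by
  have h := sesq0_eq_inner hω u u
  rw [inner_self_eq_norm_sq_to_K] at h
  have h2 : sesq0 ω θ u u = ((form0 ω θ u : ℝ) : ℂ) := by
    rw [sesq0, form0, ← integral_complex_ofReal]
    refine integral_congr_ae (ae_of_all _ fun p => ?_)
    simp only
    rw [inner_self_eq_norm_sq_to_K]
    norm_cast
  rw [h2] at h
  exact Complex.ofReal_injective (by rw [h]; norm_cast)

/-- The formal adjoint of a component of the magnetic gradient. -/
theorem exists_adjoint (hω : MemLp ω 2 volume) (g : testSpace θ) (i : Fin 3) :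
    ∃ T : L2 θ, ∀ u : testSpace θ,
      inner ℂ (testToL2 θ g) (magLp θ hω u i) = inner ℂ T (testToL2 θ u) := by
  have hg : IsTest θ g := g.2
  -- Integration by parts reduces to an identity on the layer: after multiplication by the weight
  -- `r`, the two integrands differ by `i` times a derivative `D` with zero integral.
  suffices h : ∃ T : Cyl → ℂ, MemLp T 2 (cylMeasure θ) ∧ ∀ w : Cyl → ℂ, IsTest θ w →
      ∃ D : Cyl → ℂ, (∫ p, D p = 0) ∧ (∀ p ∉ Lay θ, D p = 0) ∧ ∀ p ∈ Lay θ,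
        (p.1 : ℂ) * ((starRingEnd ℂ) ((g : Cyl → ℂ) p) * magGrad ω w p i -
          (starRingEnd ℂ) (T p) * w p) = Complex.I * D p by
    obtain ⟨T, hT, h⟩ := h
    refine ⟨hT.toLp T, fun u => ?_⟩
    have hu : IsTest θ u := u.2
    refine (inner_toLp hg.memLp (memLp_magGrad hω hu i)).trans
      (Eq.trans ?_ (inner_toLp hT hu.memLp).symm)
    rw [← sub_eq_zero, ← integral_sub
      (integrable_conj_mul_of_memLp hg.memLp (memLp_magGrad hω hu i))
      (integrable_conj_mul_of_memLp hT hu.memLp),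
      integral_cylMeasure fun p hp => by simp [hg.eq_zero hp, hu.eq_zero hp]]
    obtain ⟨D, hD, hD0, hD2⟩ := h u hu
    rw [← mul_zero Complex.I, ← hD, ← integral_const_mul]
    refine integral_congr_ae (ae_of_all _ fun p => ?_)
    by_cases hp : p ∈ Lay θ
    · exact hD2 p hp
    · simp [hg.eq_zero hp, hu.eq_zero hp, hD0 p hp]
  have hprod : ∀ w : Cyl → ℂ, IsTest θ w →
      IsTest θ (fun p => (starRingEnd ℂ) ((g : Cyl → ℂ) p) * w p) :=
    fun w hw => hw.smooth_mul hg.smooth.conj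
  have hr : ∀ p ∈ Lay θ, (p.1 : ℂ) ≠ 0 := fun p hp => by
    exact_mod_cast (Lay.radius_pos hp).ne'
  fin_cases i
  -- The term `g/r` comes from differentiating the weight `r` in the measure.
  · refine ⟨fun p => Complex.I * (dr g p + (g : Cyl → ℂ) p / (p.1 : ℂ)),
      ((hg.dr.add hg.div_radius).const_mul _).memLp, fun w hw =>
        ⟨dr fun p => (p.1 : ℂ) * ((starRingEnd ℂ) ((g : Cyl → ℂ) p) * w p), ?_, ?_, ?_⟩⟩
    · exact ((hprod w hw).smooth_mul smoothCyl_radius).integral_dr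
    · exact fun p hp => ((hprod w hw).smooth_mul smoothCyl_radius).dr.eq_zero hp
    · intro p hp
      have := hr p hp
      rw [dr_mul smoothCyl_radius (hprod w hw).smooth, dr_mul hg.smooth.conj hw.smooth,
        dr_conj hg.smooth, dr_radius]
      simp only [Fin.zero_eta, magGrad_zero, map_mul, map_add, map_div₀, Complex.conj_I,
        Complex.conj_ofReal]
      field_simp
      ring
  -- The angular component is symmetric since `ω` is real; its factor `1/r` cancels the weight.
  · refine ⟨fun p => magGrad ω g p 1, memLp_magGrad hω hg 1, fun w hw =>
        ⟨dphi fun p => (starRingEnd ℂ) ((g : Cyl → ℂ) p) * w p, ?_, ?_, ?_⟩⟩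
    · exact (hprod w hw).integral_dphi
    · exact fun p hp => (hprod w hw).dphi.eq_zero hp
    · intro p hp
      have := hr p hp
      rw [dphi_mul hg.smooth.conj hw.smooth, dphi_conj hg.smooth]
      simp only [Fin.mk_one, magGrad_one, map_mul, map_sub, map_div₀, Complex.conj_I,
        Complex.conj_ofReal, Complex.ofReal_div]
      field_simp
      ring
  · refine ⟨fun p => Complex.I * dz g p, (hg.dz.const_mul _).memLp, fun w hw =>
        ⟨dz fun p => (p.1 : ℂ) * ((starRingEnd ℂ) ((g : Cyl → ℂ) p) * w p), ?_, ?_, ?_⟩⟩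
    · exact ((hprod w hw).smooth_mul smoothCyl_radius).integral_dz
    · exact fun p hp => ((hprod w hw).smooth_mul smoothCyl_radius).dz.eq_zero hp
    · intro p hp
      rw [dz_mul smoothCyl_radius (hprod w hw).smooth, dz_mul hg.smooth.conj hw.smooth,
        dz_conj hg.smooth, dz_radius]
      simp only [Fin.reduceFinMk, magGrad_two, map_mul, Complex.conj_I]
      ring

/-! ### The closed form and its associated operator, through the closed graph -/

/-- The closure of the graph of the magnetic gradient on test functions. -/
def formGraph (θ : ℝ) (hω : MemLp ω 2 volume) : Submodule ℂ (L2 θ × Fld θ) :=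
  (LinearMap.range ((testToL2 θ).prod (magLp θ hω))).topologicalClosure

theorem mem_formGraph_test (hω : MemLp ω 2 volume) (u : testSpace θ) :
    (testToL2 θ u, magLp θ hω u) ∈ formGraph θ hω :=
  Submodule.le_topologicalClosure _ ⟨u, rfl⟩

theorem isClosed_formGraph (hω : MemLp ω 2 volume) :
    IsClosed (formGraph θ hω : Set (L2 θ × Fld θ)) :=
  Submodule.isClosed_topologicalClosure _

theorem mem_formGraph_of_tendsto (hω : MemLp ω 2 volume) {w : ℕ → testSpace θ} {u : L2 θ}
    {X : Fld θ} (h1 : Tendsto (fun n => testToL2 θ (w n)) atTop (𝓝 u))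
    (h2 : Tendsto (fun n => magLp θ hω (w n)) atTop (𝓝 X)) : (u, X) ∈ formGraph θ hω :=
  (isClosed_formGraph hω).mem_of_tendsto (h1.prodMk_nhds h2)
    (Eventually.of_forall fun n => mem_formGraph_test hω (w n))

theorem exists_tendsto_of_mem_formGraph (hω : MemLp ω 2 volume) {u : L2 θ} {X : Fld θ}
    (h : (u, X) ∈ formGraph θ hω) : ∃ w : ℕ → testSpace θ,
      Tendsto (fun n => testToL2 θ (w n)) atTop (𝓝 u) ∧
      Tendsto (fun n => magLp θ hω (w n)) atTop (𝓝 X) := by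
  obtain ⟨x, hx, hlim⟩ := mem_closure_iff_seq_limit.1 h
  choose w hw using hx
  refine ⟨w, ?_, ?_⟩
  · refine ((continuous_fst.tendsto _).comp hlim).congr fun n => ?_
    rw [Function.comp_apply, ← hw n]; rfl
  · refine ((continuous_snd.tendsto _).comp hlim).congr fun n => ?_
    rw [Function.comp_apply, ← hw n]; rfl

theorem eq_zero_of_forall_inner_test (F : L2 θ)
    (h : ∀ g : testSpace θ, inner ℂ (testToL2 θ g) F = 0) : F = 0 := by
  refine eq_zero_of_forall_isTest F fun g hg => ?_
  rw [← h ⟨g, hg⟩, ← Lp.toLp_coeFn F (Lp.memLp F)]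
  refine Eq.trans ?_ (inner_toLp hg.memLp (Lp.memLp F)).symm
  rw [Lp.toLp_coeFn]

/-- The magnetic gradient is closable. -/
theorem formGraph_eq_zero (hω : MemLp ω 2 volume) {X : Fld θ}
    (h : ((0 : L2 θ), X) ∈ formGraph θ hω) : X = 0 := by
  ext1 i
  refine eq_zero_of_forall_inner_test _ fun g => ?_
  -- Moving the gradient onto `g` gives `⟨g, X i⟩ = lim ⟨T, w n⟩ = 0`, since `w n → 0` in `L²`.
  obtain ⟨T, hT⟩ := exists_adjoint hω g i
  obtain ⟨w, h1, h2⟩ := exists_tendsto_of_mem_formGraph hω h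
  have h3 : Tendsto (fun n => magLp θ hω (w n) i) atTop (𝓝 (X i)) :=
    ((PiLp.continuous_apply 2 _ i).tendsto X).comp h2
  have h4 : Tendsto (fun n => inner ℂ (testToL2 θ g) (magLp θ hω (w n) i)) atTop
      (𝓝 (inner ℂ (testToL2 θ g) (X i))) := tendsto_const_nhds.inner h3
  have h5 : Tendsto (fun n => inner ℂ T (testToL2 θ (w n))) atTop (𝓝 (inner ℂ T (0 : L2 θ))) :=
    tendsto_const_nhds.inner h1
  simp only [hT] at h4
  rw [tendsto_nhds_unique h4 h5, inner_zero_right]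

theorem formGraph_unique (hω : MemLp ω 2 volume) {u : L2 θ} {X Y : Fld θ}
    (hX : (u, X) ∈ formGraph θ hω) (hY : (u, Y) ∈ formGraph θ hω) : X = Y := by
  have h := (formGraph θ hω).sub_mem hX hY
  rw [Prod.mk_sub_mk, sub_self] at h
  exact sub_eq_zero.1 (formGraph_eq_zero hω h)

theorem tendsto_testToL2_iff (w : ℕ → testSpace θ) (u : L2 θ) :
    Tendsto (fun n => eLpNorm (fun p => (w n : Cyl → ℂ) p - u p) 2 (cylMeasure θ)) atTop (𝓝 0) ↔
      Tendsto (fun n => testToL2 θ (w n)) atTop (𝓝 u) := by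
  rw [Lp.tendsto_Lp_iff_tendsto_eLpNorm']
  refine tendsto_congr fun n => eLpNorm_congr_ae ?_
  filter_upwards [(IsTest.memLp (w n).2).coeFn_toLp] with p hp
  rw [Pi.sub_apply, ← hp]
  rfl

/-- The form of a difference is the squared distance of the gradients, so the Cauchy condition for
the form is a Cauchy condition in a complete space. -/
theorem formConv_iff (hω : MemLp ω 2 volume) (w : ℕ → testSpace θ) (u : L2 θ) :
    FormConv ω θ (fun n => w n) u ↔ Tendsto (fun n => testToL2 θ (w n)) atTop (𝓝 u) ∧
      CauchySeq (fun n => magLp θ hω (w n)) := by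
  have hform : ∀ m n, form0 ω θ (fun p => (w n : Cyl → ℂ) p - (w m : Cyl → ℂ) p) =
      dist (magLp θ hω (w n)) (magLp θ hω (w m)) ^ 2 := fun m n => by
    rw [dist_eq_norm, ← map_sub, ← form0_eq_norm_sq]
    rfl
  rw [FormConv, tendsto_testToL2_iff, Metric.cauchySeq_iff]
  simp only [hform]
  constructor
  · rintro ⟨-, h1, h2⟩
    refine ⟨h1, fun ε hε => ?_⟩
    obtain ⟨N, hN⟩ := h2 (ε ^ 2) (by positivity)
    exact ⟨N, fun n hn m hm => lt_of_pow_lt_pow_left₀ 2 hε.le (hN n hn m hm)⟩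
  · rintro ⟨h1, h2⟩
    refine ⟨fun n => (w n).2, h1, fun ε hε => ?_⟩
    obtain ⟨N, hN⟩ := h2 (Real.sqrt ε) (Real.sqrt_pos.2 hε)
    refine ⟨N, fun n hn m hm => ?_⟩
    have := pow_lt_pow_left₀ (hN n hn m hm) dist_nonneg two_ne_zero
    rwa [Real.sq_sqrt hε.le] at this

theorem FormConv.exists_limit (hω : MemLp ω 2 volume) {w : ℕ → Cyl → ℂ} {u : L2 θ}
    (h : FormConv ω θ w u) : ∃ (w' : ℕ → testSpace θ) (X : Fld θ), (∀ n, (w' n : Cyl → ℂ) = w n) ∧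
      Tendsto (fun n => magLp θ hω (w' n)) atTop (𝓝 X) ∧ (u, X) ∈ formGraph θ hω := by
  let w' : ℕ → testSpace θ := fun n => ⟨w n, h.1 n⟩
  obtain ⟨h1, h2⟩ := (formConv_iff hω w' u).1 h
  obtain ⟨X, hX⟩ := cauchySeq_tendsto_of_complete h2
  exact ⟨w', X, fun _ => rfl, hX, mem_formGraph_of_tendsto hω h1 hX⟩

theorem formClosable (hω : MemLp ω 2 volume) : FormClosable ω θ := by
  intro w hw
  obtain ⟨w', X, hw', hX, hmem⟩ := hw.exists_limit hω
  rw [formGraph_eq_zero hω hmem] at hX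
  have h := (hX.norm).pow 2
  rw [norm_zero, zero_pow two_ne_zero] at h
  exact h.congr fun n => by rw [← form0_eq_norm_sq, hw']

theorem exists_formConv (hω : MemLp ω 2 volume) {u : L2 θ} {X : Fld θ}
    (h : (u, X) ∈ formGraph θ hω) : ∃ w, FormConv ω θ w u := by
  obtain ⟨w, h1, h2⟩ := exists_tendsto_of_mem_formGraph hω h
  exact ⟨fun n => w n, (formConv_iff hω w u).2 ⟨h1, h2.cauchySeq⟩⟩

theorem mem_domQ_iff (hω : MemLp ω 2 volume) {u : L2 θ} :
    u ∈ domQ ω θ ↔ ∃ X, (u, X) ∈ formGraph θ hω :=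
  ⟨fun ⟨_, hw⟩ => let ⟨_, X, _, _, hX⟩ := hw.exists_limit hω; ⟨X, hX⟩,
    fun ⟨_, hX⟩ => exists_formConv hω hX⟩

/-- Every pair of form-converging sequences has gradients tending to the unique partners `X` and
`Y`, so the inner product is an admissible limit. Such sequences exist, so the value chosen by
`Classical.epsilon` must agree with it. -/
theorem sesqQ_eq_inner (hω : MemLp ω 2 volume) {u v : L2 θ} {X Y : Fld θ}
    (hX : (u, X) ∈ formGraph θ hω) (hY : (v, Y) ∈ formGraph θ hω) :
    sesqQ ω θ u v = inner ℂ X Y := by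
  have key : ∀ w w' : ℕ → Cyl → ℂ, FormConv ω θ w u → FormConv ω θ w' v →
      Tendsto (fun n => sesq0 ω θ (w n) (w' n)) atTop (𝓝 (inner ℂ X Y)) := by
    intro w w' hw hw'
    obtain ⟨a, X', ha, haX, hmX⟩ := hw.exists_limit hω
    obtain ⟨b, Y', hb, hbY, hmY⟩ := hw'.exists_limit hω
    rw [formGraph_unique hω hX hmX, formGraph_unique hω hY hmY]
    refine (haX.inner hbY).congr fun n => ?_
    rw [← sesq0_eq_inner, ha, hb]
  obtain ⟨w, hw⟩ := exists_formConv hω hX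
  obtain ⟨w', hw'⟩ := exists_formConv hω hY
  have hspec := Classical.epsilon_spec (p := fun c : ℂ => ∀ w w' : ℕ → Cyl → ℂ,
    FormConv ω θ w u → FormConv ω θ w' v →
      Tendsto (fun n => sesq0 ω θ (w n) (w' n)) atTop (𝓝 c)) ⟨_, key⟩
  exact tendsto_nhds_unique (hspec w w' hw hw') (key w w' hw hw')

theorem mem_assocGraph_iff (hω : MemLp ω 2 volume) {u f : L2 θ} {X : Fld θ}
    (hX : (u, X) ∈ formGraph θ hω) :
    (u, f) ∈ assocGraph ω θ ↔ ∀ v Y, (v, Y) ∈ formGraph θ hω → inner ℂ X Y = inner ℂ f v := by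
  constructor
  · intro h v Y hY
    rw [← sesqQ_eq_inner hω hX hY]
    exact h.2 v ((mem_domQ_iff hω).2 ⟨Y, hY⟩)
  · intro h
    refine ⟨(mem_domQ_iff hω).2 ⟨X, hX⟩, fun v hv => ?_⟩
    obtain ⟨Y, hY⟩ := (mem_domQ_iff hω).1 hv
    rw [← h v Y hY]
    exact sesqQ_eq_inner hω hX hY

theorem exists_of_mem_assocGraph (hω : MemLp ω 2 volume) {u f : L2 θ}
    (h : (u, f) ∈ assocGraph ω θ) : ∃ X, (u, X) ∈ formGraph θ hω :=
  (mem_domQ_iff hω).1 h.1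

/-- The graph of the operator associated with the form, as a subspace. -/
def assocSubmodule (θ : ℝ) (hω : MemLp ω 2 volume) : Submodule ℂ (L2 θ × L2 θ) where
  carrier := assocGraph ω θ
  add_mem' := by
    rintro ⟨u, f⟩ ⟨v, g⟩ hu hv
    obtain ⟨X, hX⟩ := exists_of_mem_assocGraph hω hu
    obtain ⟨Y, hY⟩ := exists_of_mem_assocGraph hω hv
    refine (mem_assocGraph_iff hω ((formGraph θ hω).add_mem hX hY)).2 fun x Z hZ => ?_
    rw [inner_add_left, inner_add_left, (mem_assocGraph_iff hω hX).1 hu x Z hZ,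
      (mem_assocGraph_iff hω hY).1 hv x Z hZ]
  zero_mem' := (mem_assocGraph_iff hω (formGraph θ hω).zero_mem).2 fun x Z _ => by
    rw [inner_zero_left, inner_zero_left]
  smul_mem' := by
    rintro c ⟨u, f⟩ hu
    obtain ⟨X, hX⟩ := exists_of_mem_assocGraph hω hu
    refine (mem_assocGraph_iff hω ((formGraph θ hω).smul_mem c hX)).2 fun x Z hZ => ?_
    rw [inner_smul_left, inner_smul_left, (mem_assocGraph_iff hω hX).1 hu x Z hZ]

/-- Two things are at stake: the span adds nothing, because the associated graph is a subspace, and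
the relation is single-valued, because `f` paired with `u = 0` is orthogonal to all test functions.
-/
theorem graph_opH (hω : MemLp ω 2 volume) :
    ((opH ω θ).graph : Set (L2 θ × L2 θ)) = assocGraph ω θ := by
  have hspan : Submodule.span ℂ (assocGraph ω θ) = assocSubmodule θ hω :=
    Submodule.span_eq (assocSubmodule θ hω)
  rw [opH, hspan, Submodule.toLinearPMap_graph_eq]
  · rfl
  · rintro ⟨u, f⟩ hx hu
    have hu0 : u = 0 := hu
    subst hu0
    refine eq_zero_of_forall_inner_test f fun g => ?_
    have h := (mem_assocGraph_iff hω (formGraph θ hω).zero_mem).1 hx _ _ (mem_formGraph_test hω g)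
    rw [inner_zero_left] at h
    rw [← inner_conj_symm, ← h, map_zero]

end

/-! ### Transport of forms and operators by unitary maps -/

section

variable {θ : ℝ} {ω₁ ω₂ : S1 → ℝ}

/-- Both maps are continuous and the target graph is closed, so checking test functions is enough;
their images need not be test functions. -/
theorem map_formGraph (h₁ : MemLp ω₁ 2 volume) (h₂ : MemLp ω₂ 2 volume)
    (U : L2 θ ≃ₗᵢ[ℂ] L2 θ) (W : Fld θ ≃ₗᵢ[ℂ] Fld θ)
    (h : ∀ u : testSpace θ, (U (testToL2 θ u), W (magLp θ h₁ u)) ∈ formGraph θ h₂)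
    {u : L2 θ} {X : Fld θ} (hX : (u, X) ∈ formGraph θ h₁) : (U u, W X) ∈ formGraph θ h₂ := by
  obtain ⟨w, hw1, hw2⟩ := exists_tendsto_of_mem_formGraph h₁ hX
  exact (isClosed_formGraph h₂).mem_of_tendsto
    (((U.continuous.tendsto _).comp hw1).prodMk_nhds ((W.continuous.tendsto _).comp hw2))
    (Eventually.of_forall fun n => h (w n))

/-- The unitary map `U` carries the form `Q_{ω₁,θ}` to `Q_{ω₂,θ}` through `W`. -/
structure FormEquiv (h₁ : MemLp ω₁ 2 volume) (h₂ : MemLp ω₂ 2 volume)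
    (U : L2 θ ≃ₗᵢ[ℂ] L2 θ) (W : Fld θ ≃ₗᵢ[ℂ] Fld θ) : Prop where
  map : ∀ {u X}, (u, X) ∈ formGraph θ h₁ → (U u, W X) ∈ formGraph θ h₂
  symm_map : ∀ {u X}, (u, X) ∈ formGraph θ h₂ → (U.symm u, W.symm X) ∈ formGraph θ h₁

variable {h₁ : MemLp ω₁ 2 volume} {h₂ : MemLp ω₂ 2 volume}
  {U : L2 θ ≃ₗᵢ[ℂ] L2 θ} {W : Fld θ ≃ₗᵢ[ℂ] Fld θ}

theorem FormEquiv.domQ_eq (e : FormEquiv h₁ h₂ U W) : domQ ω₂ θ = U '' domQ ω₁ θ := by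
  ext u
  constructor
  · intro hu
    obtain ⟨X, hX⟩ := (mem_domQ_iff h₂).1 hu
    exact ⟨U.symm u, (mem_domQ_iff h₁).2 ⟨_, e.symm_map hX⟩, U.apply_symm_apply u⟩
  · rintro ⟨u, hu, rfl⟩
    obtain ⟨X, hX⟩ := (mem_domQ_iff h₁).1 hu
    exact (mem_domQ_iff h₂).2 ⟨_, e.map hX⟩

theorem FormEquiv.formQ_eq (e : FormEquiv h₁ h₂ U W) {u : L2 θ} (hu : u ∈ domQ ω₁ θ) :
    formQ ω₂ θ (U u) = formQ ω₁ θ u := by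
  obtain ⟨X, hX⟩ := (mem_domQ_iff h₁).1 hu
  rw [formQ, formQ, sesqQ_eq_inner h₁ hX hX, sesqQ_eq_inner h₂ (e.map hX) (e.map hX),
    W.inner_map_map]

/-- Each test vector of the target form is pulled back by `U.symm` and `W.symm`; both pairings are
preserved by unitarity. -/
theorem FormEquiv.mem_assocGraph (e : FormEquiv h₁ h₂ U W) {u f : L2 θ}
    (h : (u, f) ∈ assocGraph ω₁ θ) : (U u, U f) ∈ assocGraph ω₂ θ := by
  obtain ⟨X, hX⟩ := exists_of_mem_assocGraph h₁ h
  refine (mem_assocGraph_iff h₂ (e.map hX)).2 fun v Y hY => ?_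
  rw [← W.apply_symm_apply Y, ← U.apply_symm_apply v, W.inner_map_map, U.inner_map_map]
  exact (mem_assocGraph_iff h₁ hX).1 h _ _ (e.symm_map hY)

theorem FormEquiv.symm (e : FormEquiv h₁ h₂ U W) : FormEquiv h₂ h₁ U.symm W.symm :=
  ⟨e.symm_map, e.map⟩

theorem mem_graph_opH (hω : MemLp ω₁ 2 volume) {x : L2 θ × L2 θ} :
    x ∈ (opH ω₁ θ).graph ↔ x ∈ assocGraph ω₁ θ := by
  rw [← graph_opH hω]; rfl

theorem FormEquiv.intertwines (e : FormEquiv h₁ h₂ U W) :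
    Intertwines U (opH ω₁ θ) (opH ω₂ θ) := by
  constructor
  · ext u
    constructor
    · intro hu
      obtain ⟨f, hf⟩ := LinearPMap.mem_domain_iff.1 hu
      have h := e.symm.mem_assocGraph ((mem_graph_opH h₂).1 hf)
      exact ⟨U.symm u, LinearPMap.mem_domain_iff.2 ⟨_, (mem_graph_opH h₁).2 h⟩,
        U.apply_symm_apply u⟩
    · rintro ⟨u, hu, rfl⟩
      obtain ⟨f, hf⟩ := LinearPMap.mem_domain_iff.1 hu
      exact LinearPMap.mem_domain_iff.2
        ⟨_, (mem_graph_opH h₂).2 (e.mem_assocGraph ((mem_graph_opH h₁).1 hf))⟩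
  · intro x y hxy
    have h : (U x, U (opH ω₁ θ x)) ∈ (opH ω₂ θ).graph :=
      (mem_graph_opH h₂).2 (e.mem_assocGraph ((mem_graph_opH h₁).1 ((opH ω₁ θ).mem_graph x)))
    rw [← hxy] at h
    exact ((LinearPMap.image_iff y.2).2 h).symm

theorem Intertwines.trans {U₁ U₂ : L2 θ ≃ₗᵢ[ℂ] L2 θ} {A B C : L2 θ →ₗ.[ℂ] L2 θ}
    (h : Intertwines U₁ A B) (h' : Intertwines U₂ B C) : Intertwines (U₁.trans U₂) A C := by
  constructor
  · rw [h'.1, h.1, image_image]; rfl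
  · intro x y hxy
    have hx : U₁ x ∈ B.domain := by
      have : U₁ x ∈ (B.domain : Set (L2 θ)) := by rw [h.1]; exact ⟨x, x.2, rfl⟩
      exact this
    rw [h'.2 ⟨U₁ x, hx⟩ y hxy, h.2 x ⟨U₁ x, hx⟩ rfl]
    rfl

/-! ### Gauge transforms as limits of smooth ones -/

/-- `g` is a limit of smooth functions of modulus one on `S¹` whose logarithmic derivatives tend to
`i (ω₁ - ω₂)`. -/
def GaugeApprox (ω₁ ω₂ : S1 → ℝ) (g : S1 → ℂ) : Prop :=
  ∀ ε > 0, ∃ (h : S1 → ℂ) (η : S1 → ℝ),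
    ContDiff ℝ ((⊤ : ℕ∞) : WithTop ℕ∞) (fun t : ℝ => h t) ∧ (∀ x, ‖h x‖ = 1) ∧
    (∀ t : ℝ, HasDerivAt (fun s : ℝ => h s) (Complex.I * η t * h t) t) ∧
    (∀ x, ‖h x - g x‖ ≤ ε) ∧ MemLp η 2 volume ∧
    eLpNorm (fun x => η x - (ω₁ x - ω₂ x)) 2 volume ≤ ENNReal.ofReal ε

/-- For modulus one, inversion preserves distances, and it changes the sign of the logarithmic
derivative; so `h⁻¹` and `-η` serve. -/
theorem GaugeApprox.inv {g : S1 → ℂ} (hn : ∀ x, ‖g x‖ = 1) (hg : GaugeApprox ω₁ ω₂ g) :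
    GaugeApprox ω₂ ω₁ (fun x => (g x)⁻¹) := by
  intro ε hε
  obtain ⟨h, η, h1, h2, h3, h4, h5, h6⟩ := hg ε hε
  have h0 : ∀ x, h x ≠ 0 := fun x hx => by simpa [hx] using h2 x
  have g0 : ∀ x, g x ≠ 0 := fun x hx => by simpa [hx] using hn x
  refine ⟨fun x => (h x)⁻¹, fun x => -η x, h1.inv fun t => h0 t, fun x => by simp [h2],
    fun t => ?_, fun x => ?_, h5.neg, ?_⟩
  · have key : ∀ a b : ℂ, a ≠ 0 → -(Complex.I * b * a) / a ^ 2 = Complex.I * -b * a⁻¹ := by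
      intro a b ha
      field_simp
    rw [Complex.ofReal_neg, ← key _ _ (h0 t)]
    exact (h3 t).fun_inv (h0 t)
  · have : (h x)⁻¹ - (g x)⁻¹ = (g x - h x) * ((h x)⁻¹ * (g x)⁻¹) := by
      have := h0 x
      have := g0 x
      field_simp
    rw [this, norm_mul, norm_mul, norm_inv, norm_inv, hn, h2, norm_sub_rev]
    simpa using h4 x
  · rw [← eLpNorm_neg]
    refine le_of_eq_of_le (congrArg (fun f => eLpNorm f 2 volume) ?_) h6
    funext x
    simp only [Pi.neg_apply]
    ring

theorem smoothCyl_angle {h : S1 → ℂ}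
    (hh : ContDiff ℝ ((⊤ : ℕ∞) : WithTop ℕ∞) (fun t : ℝ => h t)) :
    SmoothCyl (fun p => h p.2.2) := by
  have h2 : ContDiff ℝ ((⊤ : ℕ∞) : WithTop ℕ∞) fun q : ℝ × ℝ × ℝ => q.2.2 := by fun_prop
  exact hh.comp h2

/-- By the product rule the factor `h` contributes `i · iη h u / r = -η h u / r` to the angular
component. The term in brackets is the failure of `η` to equal `ω₁ - ω₂`. -/
theorem magGrad_gauge {h : S1 → ℂ} {η : S1 → ℝ} {u : Cyl → ℂ}
    (hh : ContDiff ℝ ((⊤ : ℕ∞) : WithTop ℕ∞) (fun t : ℝ => h t))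
    (hd : ∀ t : ℝ, HasDerivAt (fun s : ℝ => h s) (Complex.I * η t * h t) t)
    (hu : SmoothCyl u) (p : Cyl) (i : Fin 3) :
    magGrad ω₂ (fun p => h p.2.2 * u p) p i = h p.2.2 * (magGrad ω₁ u p i -
      (if i = 1 then ((η p.2.2 - (ω₁ p.2.2 - ω₂ p.2.2) : ℝ) : ℂ) * (u p / (p.1 : ℂ)) else 0)) := by
  have hs := smoothCyl_angle hh
  have hr : dr (fun p => h p.2.2) p = 0 := by simp [dr]
  have hz : dz (fun p => h p.2.2) p = 0 := by simp [dz]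
  have hφ : dphi (fun p => h p.2.2) p = Complex.I * η p.2.2 * h p.2.2 := by
    obtain ⟨⟨r, z, t⟩, rfl⟩ := cover_surjective p
    exact (hs.hasDerivAt_dphi r z t).unique (hd t)
  fin_cases i
  · simp [dr_mul hs hu, hr]; ring
  · simp only [Fin.mk_one, magGrad_one, dphi_mul hs hu, hφ, if_true]
    push_cast
    linear_combination (η p.2.2 : ℂ) * h p.2.2 * u p / (p.1 : ℂ) * Complex.I_sq
  · simp [dz_mul hs hu, hz]; ring

/-- Serves both the functions, with `e = 0`, and the gradient components, where `e` carries the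
error in the potential. -/
theorem norm_mulFun_sub_le {g : Cyl → ℂ} (hg : Measurable g) (hn : ∀ p, ‖g p‖ = 1)
    {f k e : Cyl → ℂ} {ε : ℝ} (hε : 0 ≤ ε) (hf : MemLp f 2 (cylMeasure θ))
    (hk : MemLp k 2 (cylMeasure θ)) (he : MemLp e 2 (cylMeasure θ))
    (hb : ∀ p, ‖g p * f p - k p‖ ≤ ε * ‖f p‖ + ‖e p‖) :
    ‖mulFun g hg hn (hf.toLp f) - hk.toLp k‖ ≤ ε * ‖hf.toLp f‖ + ‖he.toLp e‖ := by
  have h1 : eLpNorm (fun p => g p * f p - k p) 2 (cylMeasure θ) ≤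
      ENNReal.ofReal ε * eLpNorm f 2 (cylMeasure θ) + eLpNorm e 2 (cylMeasure θ) := by
    refine (eLpNorm_mono_real hb).trans ((eLpNorm_add_le (hf.1.norm.const_mul ε) he.1.norm
      (by norm_num)).trans (add_le_add ?_ (eLpNorm_norm e).le))
    refine (eLpNorm_const_smul ε (fun p => ‖f p‖) 2 (cylMeasure θ)).le.trans_eq ?_
    rw [eLpNorm_norm, Real.enorm_eq_ofReal hε]
  have h2 : eLpNorm (⇑(mulFun g hg hn (hf.toLp f) - hk.toLp k)) 2 (cylMeasure θ) =
      eLpNorm (fun p => g p * f p - k p) 2 (cylMeasure θ) := by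
    refine eLpNorm_congr_ae ?_
    filter_upwards [Lp.coeFn_sub (mulFun g hg hn (hf.toLp f)) (hk.toLp k), hk.coeFn_toLp,
      hf.coeFn_toLp, coeFn_mulFun g hg hn (hf.toLp f)] with p a b c d
    rw [a, Pi.sub_apply, b, d, c]
  rw [Lp.norm_def, h2, Lp.norm_toLp, Lp.norm_toLp]
  have h3 := ENNReal.toReal_mono
    (ENNReal.add_ne_top.2 ⟨ENNReal.mul_ne_top ENNReal.ofReal_ne_top hf.2.ne, he.2.ne⟩) h1
  rwa [ENNReal.toReal_add (ENNReal.mul_ne_top ENNReal.ofReal_ne_top hf.2.ne) he.2.ne,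
    ENNReal.toReal_mul, ENNReal.toReal_ofReal hε] at h3

/-- Unitary operators applied to the components of a field. -/
def fldCongr (θ : ℝ) (U : Fin 3 → (L2 θ ≃ₗᵢ[ℂ] L2 θ)) : Fld θ ≃ₗᵢ[ℂ] Fld θ :=
  LinearIsometryEquiv.piLpCongrRight 2 U

theorem tendsto_fld {X : ℕ → Fld θ} {Y : Fld θ}
    (h : ∀ i, Tendsto (fun n => X n i) atTop (𝓝 (Y i))) : Tendsto X atTop (𝓝 Y) :=
  ((PiLp.continuous_toLp 2 fun _ : Fin 3 => L2 θ).tendsto Y.ofLp).comp (tendsto_pi_nhds.2 h)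

/-- The test functions `h n · u` converge to `g u` because `h n → g` uniformly. Their gradients
converge to `g` times the gradient of `u`, since the angular error is `η n - (ω₁ - ω₂)`, small in
`L²(S¹)`, times the fixed test function `u/r`. -/
theorem gauge_mem_formGraph (h₁ : MemLp ω₁ 2 volume) (h₂ : MemLp ω₂ 2 volume) {g : S1 → ℂ}
    (hg : GaugeApprox ω₁ ω₂ g) (hm : Measurable fun p : Cyl => g p.2.2)
    (hn : ∀ p : Cyl, ‖g p.2.2‖ = 1) (u : testSpace θ) :
    (mulFun (fun p : Cyl => g p.2.2) hm hn (testToL2 θ u),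
      WithLp.toLp 2 fun i => mulFun (fun p : Cyl => g p.2.2) hm hn (magLp θ h₁ u i)) ∈
        formGraph θ h₂ := by
  have hu : IsTest θ u := u.2
  choose h η hsm hh1 hd hclose hη hηε using fun n : ℕ => hg (1 / (n + 1 : ℝ)) (by positivity)
  have hε0 : ∀ n : ℕ, 0 ≤ 1 / (n + 1 : ℝ) := fun n => by positivity
  let w : ℕ → testSpace θ := fun n =>
    ⟨fun p => h n p.2.2 * (u : Cyl → ℂ) p, hu.smooth_mul (smoothCyl_angle (hsm n))⟩
  refine mem_formGraph_of_tendsto h₂ (w := w) ?_ (tendsto_fld fun i => ?_)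
  · rw [tendsto_iff_norm_sub_tendsto_zero]
    refine squeeze_zero (g := fun n : ℕ => 1 / (n + 1 : ℝ) * ‖testToL2 θ u‖)
      (fun _ => norm_nonneg _) (fun n => ?_) ?_
    · rw [norm_sub_rev]
      refine (norm_mulFun_sub_le hm hn (hε0 n) hu.memLp (IsTest.memLp (w n).2)
        (MemLp.zero' : MemLp (fun _ : Cyl => (0 : ℂ)) 2 (cylMeasure θ)) fun p => ?_).trans_eq ?_
      · change ‖g p.2.2 * (u : Cyl → ℂ) p - h n p.2.2 * (u : Cyl → ℂ) p‖ ≤ _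
        rw [← sub_mul, norm_mul, norm_sub_rev, norm_zero, add_zero]
        exact mul_le_mul_of_nonneg_right (hclose n p.2.2) (norm_nonneg _)
      · rw [Lp.norm_toLp (fun _ : Cyl => (0 : ℂ))]
        simp only [eLpNorm_zero', ENNReal.toReal_zero, add_zero]
        rfl
    · simpa using tendsto_one_div_add_atTop_nhds_zero_nat.mul_const ‖testToL2 θ u‖
  · obtain ⟨C, hC⟩ := hu.div_radius.exists_eLpNorm_mul_le
    rw [tendsto_iff_norm_sub_tendsto_zero]
    refine squeeze_zero (g := fun n : ℕ => 1 / (n + 1 : ℝ) * (‖magLp θ h₁ u i‖ + C))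
      (fun _ => norm_nonneg _) (fun n => ?_) ?_
    · rw [norm_sub_rev]
      have hηm : MemLp (fun x => η n x - (ω₁ x - ω₂ x)) 2 volume := (hη n).sub (h₁.sub h₂)
      have he := hu.div_radius.memLp_mul hηm
      refine (norm_mulFun_sub_le hm hn (hε0 n) (memLp_magGrad h₁ hu i)
        (memLp_magGrad h₂ (w n).2 i) he fun p => ?_).trans ?_
      · change ‖g p.2.2 * magGrad ω₁ u p i -
          magGrad ω₂ (fun p => h n p.2.2 * (u : Cyl → ℂ) p) p i‖ ≤ _
        rw [magGrad_gauge (ω₁ := ω₁) (hsm n) (hd n) hu.smooth p i, mul_sub, ← sub_add, ← sub_mul]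
        refine (norm_add_le _ _).trans (add_le_add ?_ ?_)
        · rw [norm_mul, norm_sub_rev]
          exact mul_le_mul_of_nonneg_right (hclose n p.2.2) (norm_nonneg _)
        · rw [norm_mul, hh1, one_mul]
          split_ifs
          · exact le_rfl
          · rw [norm_zero]; exact norm_nonneg _
      · rw [mul_add]
        refine add_le_add le_rfl ?_
        rw [Lp.norm_toLp]
        have h3 := (hC _ hηm.1).trans (mul_le_mul_right (hηε n) _)
        have h4 := ENNReal.toReal_mono (ENNReal.mul_ne_top ENNReal.coe_ne_top
          ENNReal.ofReal_ne_top) h3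
        rw [ENNReal.toReal_mul, ENNReal.toReal_ofReal (hε0 n), ENNReal.coe_toReal] at h4
        exact h4.trans_eq (mul_comm _ _)
    · simpa using tendsto_one_div_add_atTop_nhds_zero_nat.mul_const (‖magLp θ h₁ u i‖ + C)

theorem formEquiv_mulUnitary (h₁ : MemLp ω₁ 2 volume) (h₂ : MemLp ω₂ 2 volume) {g : S1 → ℂ}
    (hg : GaugeApprox ω₁ ω₂ g) (hm : Measurable fun p : Cyl => g p.2.2) (hn : ∀ x, ‖g x‖ = 1) :
    FormEquiv h₁ h₂ (mulUnitary θ (fun p => g p.2.2) hm fun p => hn p.2.2)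
      (fldCongr θ fun _ => mulUnitary θ (fun p => g p.2.2) hm fun p => hn p.2.2) where
  map hX := map_formGraph h₁ h₂ _ _
    (fun u => gauge_mem_formGraph h₁ h₂ hg hm (fun p => hn p.2.2) u) hX
  symm_map hX := map_formGraph h₂ h₁ _ _
    (fun u => gauge_mem_formGraph h₂ h₁ (hg.inv hn) hm.inv (fun p => by simp [hn]) u) hX

end

/-! ### Smooth approximation on the circle with prescribed mean -/

/-- Trigonometric polynomials are dense in `L²(S¹)`. -/
theorem exists_smooth_approx {f : S1 → ℂ} (hf : MemLp f 2 (AddCircle.haarAddCircle : Measure S1))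
    {ε : ℝ} (hε : 0 < ε) :
    ∃ q : S1 → ℂ, Continuous q ∧ ContDiff ℝ ((⊤ : ℕ∞) : WithTop ℕ∞) (fun t : ℝ => q t) ∧
      eLpNorm (fun x => q x - f x) 2 AddCircle.haarAddCircle ≤ ENNReal.ofReal ε := by
  have hmem : hf.toLp f ∈
      (Submodule.span ℂ (range (@fourierLp (2 * Real.pi) _ 2 _))).topologicalClosure := by
    rw [span_fourierLp_closure_eq_top (by norm_num)]; trivial
  obtain ⟨P, hP, hPf⟩ := Metric.mem_closure_iff.1 hmem ε hε
  have key : ∃ q : S1 → ℂ, Continuous q ∧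
      ContDiff ℝ ((⊤ : ℕ∞) : WithTop ℕ∞) (fun t : ℝ => q t) ∧
        P =ᵐ[AddCircle.haarAddCircle] q := by
    refine Submodule.span_induction
      (p := fun (P : Lp ℂ 2 (AddCircle.haarAddCircle : Measure S1)) _ =>
        ∃ q : S1 → ℂ, Continuous q ∧ ContDiff ℝ ((⊤ : ℕ∞) : WithTop ℕ∞) (fun t : ℝ => q t) ∧
        P =ᵐ[AddCircle.haarAddCircle] q) ?_ ?_ ?_ ?_ hP
    · rintro _ ⟨n, rfl⟩
      refine ⟨fourier n, map_continuous _, ?_, coeFn_fourierLp 2 n⟩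
      simp only [fourier_coe_apply]
      refine Complex.contDiff_exp.comp (ContDiff.div_const (contDiff_const.mul ?_) _)
      exact Complex.ofRealCLM.contDiff
    · exact ⟨fun _ => 0, continuous_const, contDiff_const, Lp.coeFn_zero _ _ _⟩
    · rintro P Q - - ⟨p, hp1, hp2, hp3⟩ ⟨q, hq1, hq2, hq3⟩
      exact ⟨fun x => p x + q x, hp1.add hq1, hp2.add hq2,
        (Lp.coeFn_add P Q).trans (hp3.add hq3)⟩
    · rintro c P - ⟨p, hp1, hp2, hp3⟩
      exact ⟨fun x => c • p x, hp1.const_smul c, hp2.const_smul c,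
        (Lp.coeFn_smul c P).trans (hp3.const_smul c)⟩
  obtain ⟨q, hq1, hq2, hq3⟩ := key
  refine ⟨q, hq1, hq2, ?_⟩
  have h1 : eLpNorm (fun x => q x - f x) 2 AddCircle.haarAddCircle =
      eLpNorm (⇑(P - hf.toLp f)) 2 AddCircle.haarAddCircle := by
    refine eLpNorm_congr_ae ?_
    filter_upwards [hq3, hf.coeFn_toLp, Lp.coeFn_sub P (hf.toLp f)] with x a b c
    rw [c, Pi.sub_apply, a, b]
  rw [h1, ← ENNReal.ofReal_toReal (Lp.eLpNorm_ne_top _), ← Lp.norm_def, ← dist_eq_norm, dist_comm]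
  exact ENNReal.ofReal_le_ofReal hPf.le

theorem integral_volume_eq (f : S1 → ℝ) :
    ∫ x, f x = 2 * Real.pi * ∫ x, f x ∂AddCircle.haarAddCircle := by
  rw [volume_eq_haar, integral_smul_measure, ENNReal.toReal_ofReal Real.two_pi_pos.le, smul_eq_mul]

theorem integral_abs_le_of_eLpNorm {f : S1 → ℝ} {ε : ℝ} (hε : 0 ≤ ε)
    (hf : AEStronglyMeasurable f (AddCircle.haarAddCircle : Measure S1))
    (h : eLpNorm f 2 AddCircle.haarAddCircle ≤ ENNReal.ofReal ε) :
    ∫ x, |f x| ∂AddCircle.haarAddCircle ≤ ε := by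
  have h1 : eLpNorm f 1 AddCircle.haarAddCircle ≤ ENNReal.ofReal ε :=
    (eLpNorm_le_eLpNorm_of_exponent_le (by norm_num) hf).trans h
  rw [eLpNorm_one_eq_lintegral_enorm] at h1
  have h2 : ∫ x, |f x| ∂AddCircle.haarAddCircle = (∫⁻ x, ‖f x‖ₑ ∂AddCircle.haarAddCircle).toReal :=
    integral_norm_eq_lintegral_enorm hf
  rw [h2]
  exact ENNReal.toReal_le_of_le_ofReal hε h1

/-- Smooth approximation in `L²(S¹)` by functions with the same mean. -/
theorem exists_smooth_approx_mean {δ : S1 → ℝ} (hδ : MemLp δ 2 volume) {ε : ℝ} (hε : 0 < ε) :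
    ∃ η : S1 → ℝ, Continuous η ∧ ContDiff ℝ ((⊤ : ℕ∞) : WithTop ℕ∞) (fun t : ℝ => η t) ∧
      ∫ x, η x = ∫ x, δ x ∧ ∫ x, |η x - δ x| ≤ ε ∧
      eLpNorm (fun x => η x - δ x) 2 volume ≤ ENNReal.ofReal ε := by
  have hδ' := memLp_haar hδ
  -- The approximation and the correction of its mean each cost at most `ε/14` for the normalized
  -- measure, hence `ε/7` together; returning to `dφ` costs at most a factor `7 > 2π`.
  have hε' : 0 < ε / 14 := by positivity
  obtain ⟨q, hq1, hq2, hq3⟩ := exists_smooth_approx hδ'.ofReal hε'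
  let f : S1 → ℝ := fun x => (q x).re - δ x
  have hqc : Continuous fun x => (q x).re := Complex.continuous_re.comp hq1
  have hqm : MemLp (fun x => (q x).re) 2 (AddCircle.haarAddCircle : Measure S1) :=
    hqc.memLp_of_hasCompactSupport (HasCompactSupport.of_compactSpace _)
  have hfm : MemLp f 2 (AddCircle.haarAddCircle : Measure S1) := hqm.sub hδ'
  have hf : eLpNorm f 2 AddCircle.haarAddCircle ≤ ENNReal.ofReal (ε / 14) := by
    refine (eLpNorm_mono fun x => ?_).trans hq3
    have : f x = (q x - (δ x : ℂ)).re := by simp [f]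
    rw [this]
    exact Complex.abs_re_le_norm _
  -- The mean error; subtracting it from the real part of `q` restores the exact mean of `δ`.
  let c : ℝ := ∫ x, f x ∂AddCircle.haarAddCircle
  have hc : |c| ≤ ε / 14 :=
    (abs_integral_le_integral_abs).trans (integral_abs_le_of_eLpNorm hε'.le hfm.1 hf)
  have hη : eLpNorm (fun x => (q x).re - c - δ x) 2 AddCircle.haarAddCircle ≤
      ENNReal.ofReal (ε / 7) := by
    have h1 : (fun x => (q x).re - c - δ x) = f - fun _ => c := by
      funext x; simp only [f, Pi.sub_apply]; ring
    rw [h1]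
    refine (eLpNorm_sub_le hfm.1 aestronglyMeasurable_const (by norm_num)).trans ?_
    have h2 : eLpNorm (fun _ : S1 => c) 2 AddCircle.haarAddCircle ≤ ENNReal.ofReal (ε / 14) := by
      rw [eLpNorm_const c (by norm_num) (NeZero.ne _)]
      simp only [measure_univ, ENNReal.one_rpow, mul_one]
      rw [Real.enorm_eq_ofReal_abs]
      exact ENNReal.ofReal_le_ofReal hc
    refine (add_le_add hf h2).trans_eq ?_
    rw [← ENNReal.ofReal_add hε'.le hε'.le]
    congr 1
    ring
  have hηm : MemLp (fun x => (q x).re - c - δ x) 2 (AddCircle.haarAddCircle : Measure S1) :=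
    (hqm.sub (memLp_const c)).sub hδ'
  refine ⟨fun x => (q x).re - c, hqc.sub continuous_const,
    (Complex.reCLM.contDiff.comp hq2).sub contDiff_const, ?_, ?_, ?_⟩
  · rw [integral_volume_eq, integral_volume_eq]
    congr 1
    rw [integral_sub (hqm.integrable (by norm_num)) (integrable_const c), integral_const]
    simp only [c, f]
    rw [integral_sub (hqm.integrable (by norm_num)) (hδ'.integrable (by norm_num))]
    simp
  · rw [integral_volume_eq]
    have h1 := integral_abs_le_of_eLpNorm (by positivity) hηm.1 hη
    have h2 := Real.pi_lt_d2
    calc _ ≤ 2 * Real.pi * (ε / 7) := mul_le_mul_of_nonneg_left h1 Real.two_pi_pos.le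
      _ ≤ 7 * (ε / 7) := mul_le_mul_of_nonneg_right (by linarith) (by positivity)
      _ = ε := by ring
  · rw [volume_eq_haar, eLpNorm_smul_measure_of_ne_top (by norm_num)]
    have h2 := Real.pi_lt_d2
    have h3 : ENNReal.ofReal (2 * Real.pi) ^ (1 / (2 : ENNReal)).toReal ≤ ENNReal.ofReal 7 := by
      rw [show (1 / (2 : ENNReal)).toReal = 1 / 2 by simp,
        ENNReal.ofReal_rpow_of_pos Real.two_pi_pos]
      refine ENNReal.ofReal_le_ofReal ?_
      rw [← Real.sqrt_eq_rpow]
      exact Real.sqrt_le_iff.2 ⟨by norm_num, by linarith⟩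
    rw [smul_eq_mul]
    refine (mul_le_mul' h3 hη).trans_eq ?_
    rw [← ENNReal.ofReal_mul (by norm_num)]
    congr 1
    ring

/-! ### The factor `e^{iV}` and its smooth approximations -/

section

variable {ω : S1 → ℝ}

theorem intervalIntegrable_circle {f : S1 → ℝ} (hf : MemLp f 2 volume) (a b : ℝ) :
    IntervalIntegrable (fun ξ : ℝ => f (ξ : S1)) volume a b := by
  have h1 : Integrable f volume := hf.integrable (by norm_num)
  have hp : Function.Periodic (fun ξ : ℝ => f (ξ : S1)) (2 * Real.pi) := fun ξ => by simp
  have h2 : IntervalIntegrable (fun ξ : ℝ => f (ξ : S1)) volume 0 (0 + 2 * Real.pi) := by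
    rw [intervalIntegrable_iff_integrableOn_Ioc_of_le (by linarith [Real.two_pi_pos])]
    exact (AddCircle.measurePreserving_mk (2 * Real.pi) 0).integrable_comp_of_integrable h1
  exact hp.intervalIntegrable Real.two_pi_pos.ne' h2 a b

theorem integral_circle (f : S1 → ℝ) :
    ∫ ξ in (0 : ℝ)..(2 * Real.pi), f (ξ : S1) = ∫ x, f x := by
  have := AddCircle.intervalIntegral_preimage (2 * Real.pi) 0 f
  rwa [zero_add] at this

theorem memLp_constFlux (ω : S1 → ℝ) (k : ℤ) : MemLp (constFlux ω k) 2 volume := memLp_const _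

/-- The flux is the mean of `ω`, so only `k` survives; this integer is the winding number that
allows the gauge factor to close up on the circle. -/
theorem integral_constFlux_sub (hω : MemLp ω 2 volume) (k : ℤ) :
    ∫ x, (constFlux ω k x - ω x) = k * (2 * Real.pi) := by
  have hpi := Real.two_pi_pos.ne'
  rw [integral_sub ((memLp_constFlux ω k).integrable (by norm_num)) (hω.integrable (by norm_num))]
  have h1 : ∫ x, constFlux ω k x = (flux ω + k) * (2 * Real.pi) := by
    rw [integral_volume_eq]
    simp only [constFlux, integral_const, probReal_univ, one_smul]
    ring
  have h2 : flux ω = (2 * Real.pi)⁻¹ * ∫ x, ω x := by rw [flux, integral_circle]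
  rw [h1, h2]
  field_simp
  ring

theorem gaugeV_eq (hω : MemLp ω 2 volume) (k : ℤ) (t : ℝ) :
    gaugeV ω k t = ∫ ξ in (0 : ℝ)..t, (constFlux ω k (ξ : S1) - ω (ξ : S1)) := by
  rw [intervalIntegral.integral_sub (intervalIntegrable_circle (memLp_constFlux ω k) 0 t)
    (intervalIntegrable_circle hω 0 t), gaugeV]
  simp only [constFlux, intervalIntegral.integral_const, sub_zero, smul_eq_mul]
  ring

theorem norm_exp_I_sub_le (a b : ℝ) :
    ‖Complex.exp (Complex.I * a) - Complex.exp (Complex.I * b)‖ ≤ |a - b| := by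
  have h : Complex.exp (Complex.I * a) - Complex.exp (Complex.I * b) =
      Complex.exp (Complex.I * b) * (Complex.exp (Complex.I * ((a - b : ℝ) : ℂ)) - 1) := by
    rw [mul_sub, ← Complex.exp_add, mul_one]
    congr 2
    push_cast
    ring
  rw [h, norm_mul, mul_comm Complex.I (b : ℂ), Complex.norm_exp_ofReal_mul_I, one_mul]
  exact Real.norm_exp_I_mul_ofReal_sub_one_le

/-- Take `h = exp(iS)` with `S` the primitive of a smooth `η` close to `δ = Φ_ω + k - ω`. Since `V`
is the primitive of `δ` from the same base point, `|S - V| ≤ ∫|η - δ|` over one turn, which gives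
uniform closeness. -/
theorem gaugeApprox_gaugeFactor (hω : MemLp ω 2 volume) (k : ℤ) :
    GaugeApprox (constFlux ω k) ω (gaugeFactor ω k) := by
  intro ε hε
  have hδ : MemLp (fun x => constFlux ω k x - ω x) 2 volume := (memLp_constFlux ω k).sub hω
  obtain ⟨η, hηc, hηs, hηi, hη1, hη2⟩ := exists_smooth_approx_mean hδ hε
  have hηm : MemLp η 2 volume :=
    hηc.memLp_of_hasCompactSupport (HasCompactSupport.of_compactSpace _)
  have hηint := fun a b => intervalIntegrable_circle hηm a b
  let S : ℝ → ℝ := fun t => ∫ ξ in (0 : ℝ)..t, η (ξ : S1)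
  have hSd : ∀ t : ℝ, HasDerivAt S (η (t : S1)) t := fun t =>
    intervalIntegral.integral_hasDerivAt_right (hηint 0 t)
      hηs.continuous.stronglyMeasurable.stronglyMeasurableAtFilter hηs.continuous.continuousAt
  have hSs : ContDiff ℝ ((⊤ : ℕ∞) : WithTop ℕ∞) S := by
    rw [contDiff_infty_iff_deriv]
    refine ⟨fun t => (hSd t).differentiableAt, ?_⟩
    rwa [show deriv S = fun t : ℝ => η (t : S1) from funext fun t => (hSd t).deriv]
  -- Equality of the means is essential here: `S` gains exactly `2πk` per turn, so `exp(iS)`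
  -- descends to the circle.
  have hSp : ∀ t, S (t + 2 * Real.pi) = S t + k * (2 * Real.pi) := by
    intro t
    have hp : Function.Periodic (fun ξ : ℝ => η (ξ : S1)) (2 * Real.pi) := fun ξ => by simp
    have h1 := intervalIntegral.integral_add_adjacent_intervals (hηint 0 t)
      (hηint t (t + 2 * Real.pi))
    have h2 := hp.intervalIntegral_add_eq t 0
    rw [zero_add, integral_circle, hηi, integral_constFlux_sub hω k] at h2
    rw [h2] at h1
    exact h1.symm
  have hper : Function.Periodic (fun t : ℝ => Complex.exp (Complex.I * S t)) (2 * Real.pi) := by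
    intro t
    simp only [hSp]
    rw [show Complex.I * ((S t + k * (2 * Real.pi) : ℝ) : ℂ) =
      Complex.I * S t + k * (2 * Real.pi * Complex.I) by push_cast; ring]
    exact Complex.exp_periodic.int_mul k _
  have hlift : ∀ t : ℝ, hper.lift (t : S1) = Complex.exp (Complex.I * S t) :=
    fun t => hper.lift_coe t
  refine ⟨hper.lift, η, ?_, ?_, ?_, ?_, hηm, hη2⟩
  · simp only [hlift]
    exact Complex.contDiff_exp.comp (contDiff_const.mul (Complex.ofRealCLM.contDiff.comp hSs))
  · intro x
    induction x using QuotientAddGroup.induction_on with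
    | H t =>
      rw [hlift, mul_comm]
      exact Complex.norm_exp_ofReal_mul_I _
  · intro t
    simp only [hlift]
    have := ((hSd t).ofReal_comp.const_mul Complex.I).cexp
    convert this using 1
    ring
  · intro x
    -- The comparison uses the representative in `[0, 2π)`, the one on which `gaugeFactor` is
    -- defined.
    obtain ⟨t, ht⟩ : ∃ t, AddCircle.equivIco (2 * Real.pi) 0 x = t := ⟨_, rfl⟩
    have hx : x = ((t : ℝ) : S1) := by
      rw [← ht]; exact ((AddCircle.equivIco (2 * Real.pi) 0).symm_apply_apply x).symm
    rw [gaugeFactor, ht]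
    have h1 := hlift t
    rw [← hx] at h1
    rw [h1]
    refine (norm_exp_I_sub_le _ _).trans (le_trans ?_ hη1)
    rw [gaugeV_eq hω, ← intervalIntegral.integral_sub (hηint 0 t)
      (intervalIntegrable_circle hδ 0 t), ← integral_circle]
    have ht0 : (0 : ℝ) ≤ t := t.2.1
    have ht1 : (t : ℝ) ≤ 2 * Real.pi := by have := t.2.2; linarith
    refine (intervalIntegral.abs_integral_le_integral_abs ht0).trans ?_
    exact intervalIntegral.integral_mono_interval le_rfl ht0 ht1
      (ae_of_all _ fun _ => abs_nonneg _) (intervalIntegrable_circle (hηm.sub hδ).abs 0 _)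

theorem formEquiv_gaugeTransform (θ : ℝ) (hω : MemLp ω 2 volume) (k : ℤ) :
    FormEquiv (memLp_constFlux ω k) hω (gaugeTransform θ hω k)
      (fldCongr θ fun _ => gaugeTransform θ hω k) :=
  formEquiv_mulUnitary (memLp_constFlux ω k) hω (gaugeApprox_gaugeFactor hω k) _
    (norm_gaugeFactor ω k)

end

/-! ### The reflection of the angle, which reverses the sign of a constant flux -/

/-- The reflection `φ ↦ -φ`. -/
def reflect (p : Cyl) : Cyl := (p.1, p.2.1, -p.2.2)

theorem reflect_reflect (p : Cyl) : reflect (reflect p) = p := by simp [reflect]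

theorem continuous_reflect : Continuous reflect := by unfold reflect; fun_prop

theorem measurePreserving_reflect_volume : MeasurePreserving reflect volume volume :=
  (MeasurePreserving.id volume).prod
    ((MeasurePreserving.id volume).prod (Measure.measurePreserving_neg (volume : Measure S1)))

section

variable {θ : ℝ} {u : Cyl → ℂ}

theorem measurePreserving_reflect : MeasurePreserving reflect (cylMeasure θ) (cylMeasure θ) := by
  have h : MeasurePreserving reflect
      ((volume : Measure Cyl).withDensity fun p => ENNReal.ofReal p.1)
      ((volume : Measure Cyl).withDensity fun p => ENNReal.ofReal p.1) := by
    refine ⟨continuous_reflect.measurable, Measure.ext fun s hs => ?_⟩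
    rw [Measure.map_apply continuous_reflect.measurable hs,
      withDensity_apply _ (continuous_reflect.measurable hs), withDensity_apply _ hs]
    exact measurePreserving_reflect_volume.setLIntegral_comp_preimage hs
      (f := fun p : Cyl => ENNReal.ofReal p.1) (by fun_prop)
  exact h.restrict_preimage measurableSet_Lay

protected theorem IsTest.reflect (hu : IsTest θ u) : IsTest θ (fun p => u (reflect p)) := by
  have hs : tsupport (fun p => u (reflect p)) ⊆
      reflect ⁻¹' tsupport u :=
    closure_minimal (fun p hp => subset_tsupport u hp)
      ((isClosed_tsupport u).preimage continuous_reflect)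
  have hK : IsCompact (reflect ⁻¹' tsupport u) := by
    refine (IsCompact.image hu.2.1 continuous_reflect).of_isClosed_subset
      ((isClosed_tsupport u).preimage continuous_reflect)
      fun p hp => ⟨_, hp, reflect_reflect p⟩
  refine ⟨?_, hK.of_isClosed_subset (isClosed_tsupport _) hs,
    fun p hp => ?_⟩
  rotate_left
  · have h : reflect p ∈ Lay θ := hu.2.2 (hs hp)
    exact h
  have h1 : ContDiff ℝ ((⊤ : ℕ∞) : WithTop ℕ∞)
      fun q : ℝ × ℝ × ℝ => ((q.1, q.2.1, -q.2.2) : ℝ × ℝ × ℝ) := by fun_prop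
  exact ContDiff.comp (g := lift3 u) hu.1 h1

/-- Reflection reverses `∂_φ`; reversing the constant as well makes the whole angular component
change sign, which leaves norms unchanged. -/
theorem magGrad_reflect (c : ℝ) (u : Cyl → ℂ) (p : Cyl) (i : Fin 3) :
    magGrad (fun _ => -c) (fun p => u (reflect p)) p i =
      (if i = 1 then -1 else 1) * magGrad (fun _ => c) u (reflect p) i := by
  have hφ : dphi (fun p => u (reflect p)) p = -dphi u (reflect p) := by
    have h := deriv_comp_neg (fun s : ℝ => u (p.1, p.2.1, -p.2.2 + (s : S1))) 0
    rw [neg_zero] at h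
    refine Eq.trans (congrArg (fun f => deriv f 0) ?_) h
    funext s
    simp [reflect, add_comm]
  fin_cases i
  · simp [reflect, dr]
  · simp only [Fin.mk_one, magGrad_one, hφ, if_true]
    simp only [reflect]
    push_cast
    ring
  · simp [reflect, dz]

/-- The unitary operator `u ↦ u ∘ reflect`. -/
def reflectUnitary (θ : ℝ) : L2 θ ≃ₗᵢ[ℂ] L2 θ where
  toFun := Lp.compMeasurePreserving reflect measurePreserving_reflect
  invFun := Lp.compMeasurePreserving reflect measurePreserving_reflect
  map_add' := map_add _
  map_smul' c u := (Lp.compMeasurePreservingₗ ℂ reflect measurePreserving_reflect).map_smul c u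
  left_inv u := by
    apply Lp.ext
    have h1 := Lp.coeFn_compMeasurePreserving (Lp.compMeasurePreserving reflect
      (measurePreserving_reflect (θ := θ)) u) measurePreserving_reflect
    have h2 := measurePreserving_reflect.quasiMeasurePreserving.ae
      (Lp.coeFn_compMeasurePreserving u (measurePreserving_reflect (θ := θ)))
    filter_upwards [h1, h2] with p a b
    rw [a, Function.comp_apply, b, Function.comp_apply, reflect_reflect]
  right_inv u := by
    apply Lp.ext
    have h1 := Lp.coeFn_compMeasurePreserving (Lp.compMeasurePreserving reflect
      (measurePreserving_reflect (θ := θ)) u) measurePreserving_reflect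
    have h2 := measurePreserving_reflect.quasiMeasurePreserving.ae
      (Lp.coeFn_compMeasurePreserving u (measurePreserving_reflect (θ := θ)))
    filter_upwards [h1, h2] with p a b
    rw [a, Function.comp_apply, b, Function.comp_apply, reflect_reflect]
  norm_map' u := Lp.norm_compMeasurePreserving u measurePreserving_reflect

theorem reflectUnitary_toLp {f : Cyl → ℂ} (hf : MemLp f 2 (cylMeasure θ)) :
    reflectUnitary θ (hf.toLp f) =
      (hf.comp_measurePreserving measurePreserving_reflect).toLp (f ∘ reflect) :=
  Lp.toLp_compMeasurePreserving hf measurePreserving_reflect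

/-- The reflection of fields. -/
def reflectFld (θ : ℝ) : Fld θ ≃ₗᵢ[ℂ] Fld θ :=
  fldCongr θ fun i => if i = 1 then (reflectUnitary θ).trans (LinearIsometryEquiv.neg ℂ)
    else reflectUnitary θ

theorem reflectFld_symm (X : Fld θ) : (reflectFld θ).symm X = reflectFld θ X := by
  rw [LinearIsometryEquiv.symm_apply_eq]
  have hU : ∀ x : L2 θ, reflectUnitary θ (reflectUnitary θ x) = x := (reflectUnitary θ).left_inv
  ext1 i
  change X i = (if i = 1 then (reflectUnitary θ).trans (LinearIsometryEquiv.neg ℂ)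
    else reflectUnitary θ) ((if i = 1 then (reflectUnitary θ).trans (LinearIsometryEquiv.neg ℂ)
    else reflectUnitary θ) (X i))
  split_ifs
  · simp [hU]
  · exact (hU _).symm

theorem reflect_mem_formGraph {c d : ℝ} (hcd : d = -c) (u : testSpace θ) :
    (reflectUnitary θ (testToL2 θ u),
      reflectFld θ (magLp θ (memLp_const c : MemLp (fun _ : S1 => c) 2 volume) u)) ∈
        formGraph θ (memLp_const d : MemLp (fun _ : S1 => d) 2 volume) := by
  subst hcd
  have hu : IsTest θ u := u.2
  have hc : MemLp (fun _ : S1 => c) 2 volume := memLp_const c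
  let v : testSpace θ := ⟨fun p => (u : Cyl → ℂ) (reflect p), hu.reflect⟩
  have h1 : reflectUnitary θ (testToL2 θ u) = testToL2 θ v :=
    reflectUnitary_toLp hu.memLp
  have h2 : reflectFld θ (magLp θ hc u) =
      magLp θ (memLp_const (-c) : MemLp (fun _ : S1 => -c) 2 volume) v := by
    ext1 i
    have h3 : reflectUnitary θ (magLp θ hc u i) = _ := reflectUnitary_toLp (memLp_magGrad hc hu i)
    have hM := memLp_magGrad (memLp_const (-c) : MemLp (fun _ : S1 => -c) 2 volume) hu.reflect i
    change (if i = 1 then (reflectUnitary θ).trans (LinearIsometryEquiv.neg ℂ)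
      else reflectUnitary θ) (magLp θ hc u i) = hM.toLp _
    split_ifs with hi
    · rw [LinearIsometryEquiv.trans_apply, h3, LinearIsometryEquiv.coe_neg]
      beta_reduce
      rw [← MemLp.toLp_neg]
      refine (MemLp.toLp_eq_toLp_iff _ _).2 (ae_of_all _ fun p => ?_)
      beta_reduce
      rw [magGrad_reflect, if_pos hi, neg_one_mul]
      rfl
    · rw [h3]
      refine (MemLp.toLp_eq_toLp_iff _ _).2 (ae_of_all _ fun p => ?_)
      beta_reduce
      rw [magGrad_reflect, if_neg hi, one_mul]
      rfl
  rw [h1, h2]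
  exact mem_formGraph_test _ _

theorem formEquiv_reflect (θ c : ℝ) :
    FormEquiv (memLp_const c : MemLp (fun _ : S1 => c) 2 volume)
      (memLp_const (-c) : MemLp (fun _ : S1 => -c) 2 volume) (reflectUnitary θ) (reflectFld θ) where
  map hX := map_formGraph _ _ _ _ (reflect_mem_formGraph rfl) hX
  symm_map hX := by
    rw [reflectFld_symm]
    exact map_formGraph _ _ _ _ (reflect_mem_formGraph (neg_neg c).symm) hX

end

end ConicalLayer

end

/-! ### The main theorem -/

open ConicalLayer

theorem propositionA1 (θ : ℝ) (hθ : θ ∈ Set.Ioo 0 (Real.pi / 2))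
    (ω : S1 → ℝ) (hω : MeasureTheory.MemLp ω 2 MeasureTheory.volume) (k : ℤ) :
    -- the objects are well defined: `Q_{ω,θ,0}` is closable, and `H_{ω,θ}` has the defining graph
    (FormClosable ω θ ∧ ((opH ω θ).graph : Set (L2 θ × L2 θ)) = assocGraph ω θ) ∧
    -- (i)
    domQ ω θ = gaugeTransform θ hω k '' domQ (constFlux ω k) θ ∧
    -- (ii)
    (∀ u ∈ domQ (constFlux ω k) θ,
      formQ ω θ (gaugeTransform θ hω k u) = formQ (constFlux ω k) θ u) ∧
    -- unitary equivalence of the operators, through the gauge transform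
    Intertwines (gaugeTransform θ hω k) (opH (constFlux ω k) θ) (opH ω θ) ∧
    -- reduction to a constant flux in `[0, 1/2]`
    ∃ c ∈ Set.Icc (0 : ℝ) (1 / 2), (∃ m : ℤ, c = |flux ω + m|) ∧
      UnitarilyEquivalent (opH (fun _ => c) θ) (opH ω θ) := by
  have e := formEquiv_gaugeTransform θ hω
  refine ⟨⟨formClosable hω, graph_opH hω⟩, (e k).domQ_eq, fun u hu => (e k).formQ_eq hu,
    (e k).intertwines, ?_⟩
  -- Removing the nearest integer leaves a flux of absolute value at most `1/2`.
  let m : ℤ := -round (flux ω)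
  have hm : |flux ω + m| ≤ 1 / 2 := by
    have := abs_sub_round (flux ω)
    simpa [m, sub_eq_add_neg] using this
  refine ⟨|flux ω + m|, ⟨abs_nonneg _, hm⟩, ⟨m, rfl⟩, ?_⟩
  rcases le_total 0 (flux ω + m) with h | h
  · rw [abs_of_nonneg h]
    exact ⟨_, (e m).intertwines⟩
  -- A nonpositive reduced flux is the negative of its absolute value: reflect first, then apply the
  -- gauge transform with integer `m`.
  · have h1 := (formEquiv_reflect θ |flux ω + m|).intertwines
    rw [show -|flux ω + m| = flux ω + m by rw [abs_of_nonpos h, neg_neg]] at h1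
    exact ⟨_, h1.trans (e m).intertwines⟩
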